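/- All groups are abelian. For a prime $p$ and a group $G$ let $p^\omega G=\bigcap_{n\ge 0}p^nG$. A subgroup $G_1$ of $G_2$ is pure if $nG_1=G_1\cap nG_2$ for all $n\in\mathbb Z$. Let $p_1\neq p_2$ be primes. Let $\mathbf K_1=(K_1,\leq_{\mathbf K_1})$, where $K_1$ is the class of torsion-free abelian groups $G$ with $|p_1^\omega G|,|p_2^\omega G|\le\aleph_0$, and where, for $G_1,G_2\in K_1$, $G_1\leq_{\mathbf K_1}G_2$ means that $G_1$ is a pure subgroup of $G_2$, $p_1^\omega G_1=p_1^\omega G_2$, and either $G_1=p_1^\omega G_1$ or $p_2^\omega G_1=p_2^\omega G_2$. For a pair $\mathbf K=(K,\leq_{\mathbf K})$ of this kind, a $\mathbf K$-embedding $M\to N$ is an isomorphism $f$ of $M$ onto a subgroup $f[M]\leq_{\mathbf K}N$. For $N\in K$, $A\subseteq N$ and $b\in N$, the Galois type $\mathbf{gtp}(b/A;N)$ is the class of $(b,A,N)$ under the transitive closure of the following relation: $(b_1,A,N_1)$ and $(b_2,A,N_2)$ are related if there are $N\in K$ and $\mathbf K$-embeddings $f_i:N_i\to N$ fixing $A$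 pointwise with $f_1(b_1)=f_2(b_2)$. For $M\in K$, $\mathbf{gS}(M)=\{\mathbf{gtp}(b/M;N): M\leq_{\mathbf K}N,\ b\in N\}$, and the restriction of $\mathbf{gtp}(b/M;N)$ to $A\subseteq M$ is $\mathbf{gtp}(b/A;N)$. For an infinite cardinal $\lambda$, $\mathbf K$ is $(<\lambda)$-tame if for every infinite $M\in K$ any two distinct members of $\mathbf{gS}(M)$ have distinct restrictions to some $A\subseteq M$ with $|A|<\lambda$; it is $\lambda$-tame if it is $(<\lambda^+)$-tame; it is stable in $\lambda$ if $|\mathbf{gS}(M)|\le\lambda$ for every $M\in K$ with $|M|=\lambda$. **Theorem.** $\mathbf K_1$ is an abstract elementary class (in the language $\{+,-,0\}$) with Löwenheim–Skolem number $\operatorname{LS}(\mathbf K_1)=\aleph_0$, such that: 1. $\mathbf K_1$ is not $(<\aleph_0)$-tame. 2. $\mathbf K_1$ is $\aleph_0$-tame. 3. For every infinite cardinal $\lambda$, $\mathbf K_1$ is stable in $\lambda$ if and only if $\lambda^{\aleph_0}=\lambda$. 4. $\mathbf K_1$ has no maximal models (every $M\in K_1$ has a proper extension $N\in K_1$ with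 $M\leq_{\mathbf K_1}N$), but fails joint embedding (some two members of $K_1$ have no $\mathbf K_1$-embeddings into a common member) and amalgamation (some pair of $\mathbf K_1$-embeddings $f_i:M\to N_i$, $i=1,2$, admits no $N\in K_1$ and $\mathbf K_1$-embeddings $g_i:N_i\to N$ with $g_1f_1=g_2f_2$). 5. $\mathbf K_1$ admits intersections: for all $N\in K_1$ and $A\subseteq N$, the intersection $C$ of all $M\leq_{\mathbf K_1}N$ containing $A$ is in $K_1$ and $C\leq_{\mathbf K_1}N$. -/

import Mathlib

open Cardinal

universe u

/-- A class of abelian groups (structures in the finite language `{+, -, 0}`) together with a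
relation refining "is a subgroup of". `K.Strong N M` means `M ≤_K N`, where `M` is a subgroup of
`N`, regarded as a group in its own right. -/
structure GroupClass where
  /-- membership of a group in the class -/
  Mem : ∀ (G : Type u) [AddCommGroup G], Prop
  /-- `Strong N M` is the relation `M ≤_K N` -/
  Strong : ∀ (N : Type u) [AddCommGroup N], AddSubgroup N → Prop

namespace GroupClass

variable (K : GroupClass.{u})

/-- The relation `M ≤_K N` for two subgroups `M`, `N` of a common abelian group `U`. -/
def Le {U : Type u} [AddCommGroup U] (M N : AddSubgroup U) : Prop :=
  M ≤ N ∧ K.Strong N (M.addSubgroupOf N)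

/-- The Löwenheim–Skolem–Tarski property for the cardinal `μ` (the language being finite, the
requirement `μ ≥ |L| + ℵ₀` is `μ ≥ ℵ₀`). -/
def IsLSCardinal (μ : Cardinal.{u}) : Prop :=
  ℵ₀ ≤ μ ∧ ∀ (M : Type u) [AddCommGroup M], K.Mem M → ∀ A : Set M,
    ∃ M₀ : AddSubgroup M, K.Strong M M₀ ∧ A ⊆ (M₀ : Set M) ∧ #M₀ ≤ #A + μ

/-- The Löwenheim–Skolem number: the least cardinal with the Löwenheim–Skolem–Tarski property. -/
noncomputable def LS : Cardinal.{u} := sInf {μ | K.IsLSCardinal μ}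

/-- `K` is an abstract elementary class, in the language of abelian groups. Antisymmetry of `≤_K`
and the fact that `M ≤_K N` makes `M` a substructure of `N` are built into the type of `Strong`. -/
structure IsAEC : Prop where
  /-- `≤_K` is a relation between members of `K`. -/
  mem_of_strong : ∀ (N : Type u) [AddCommGroup N] (M : AddSubgroup N),
    K.Strong N M → K.Mem M ∧ K.Mem N
  /-- reflexivity of `≤_K` on `K` -/
  refl : ∀ (N : Type u) [AddCommGroup N], K.Mem N → K.Strong N ⊤
  /-- transitivity of `≤_K` -/
  trans : ∀ (N : Type u) [AddCommGroup N] (M₀ M₁ : AddSubgroup N),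
    K.Le M₀ M₁ → K.Strong N M₁ → K.Strong N M₀
  /-- `K` is closed under isomorphism. -/
  mem_iso : ∀ (N N' : Type u) [AddCommGroup N] [AddCommGroup N'], N ≃+ N' → K.Mem N → K.Mem N'
  /-- `≤_K` is closed under isomorphism. -/
  strong_iso : ∀ (N N' : Type u) [AddCommGroup N] [AddCommGroup N'] (f : N ≃+ N')
    (M : AddSubgroup N), K.Strong N M → K.Strong N' (M.map f.toAddMonoidHom)
  /-- coherence -/
  coherence : ∀ (N : Type u) [AddCommGroup N] (M₀ M₁ : AddSubgroup N),
    K.Strong N M₀ → K.Strong N M₁ → M₀ ≤ M₁ → K.Le M₀ M₁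
  /-- Tarski–Vaught axioms, including smoothness, for the union `M'` of a `≤_K`-increasing chain
  of members of `K` indexed by a limit ordinal. (`U` is any abelian group in which the chain, its
  union and the bound `N` live.) -/
  chain : ∀ (U : Type u) [AddCommGroup U] (δ : Ordinal.{u}), Order.IsSuccLimit δ →
    ∀ M : Set.Iio δ → AddSubgroup U, (∀ i, K.Mem (M i)) → (∀ i j, i ≤ j → K.Le (M i) (M j)) →
    ∀ M' : AddSubgroup U, (M' : Set U) = ⋃ i, (M i : Set U) →
      K.Mem M' ∧ (∀ i, K.Le (M i) M') ∧
      ∀ N : AddSubgroup U, K.Mem N → (∀ i, K.Le (M i) N) → K.Le M' N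
  /-- Löwenheim–Skolem–Tarski axiom -/
  lst : ∃ μ : Cardinal.{u}, K.IsLSCardinal μ

/-- `f : M → N` is a `K`-embedding: it is an isomorphism onto its image, and `f[M] ≤_K N`. -/
def IsEmb {M N : Type u} [AddCommGroup M] [AddCommGroup N] (f : M →+ N) : Prop :=
  Function.Injective f ∧ K.Strong N f.range

/-- No maximal models: every member of `K` has a proper `≤_K`-extension. -/
def NoMaximalModels : Prop :=
  ∀ (M : Type u) [AddCommGroup M], K.Mem M →
    ∃ (N : Type u) (_ : AddCommGroup N) (f : M →+ N),
      K.Mem N ∧ K.IsEmb f ∧ ¬ Function.Surjective f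

/-- The joint embedding property. -/
def JointEmbedding : Prop :=
  ∀ (M₁ M₂ : Type u) [AddCommGroup M₁] [AddCommGroup M₂], K.Mem M₁ → K.Mem M₂ →
    ∃ (N : Type u) (_ : AddCommGroup N) (f₁ : M₁ →+ N) (f₂ : M₂ →+ N),
      K.Mem N ∧ K.IsEmb f₁ ∧ K.IsEmb f₂

/-- The amalgamation property. -/
def Amalgamation : Prop :=
  ∀ (M N₁ N₂ : Type u) [AddCommGroup M] [AddCommGroup N₁] [AddCommGroup N₂]
    (f₁ : M →+ N₁) (f₂ : M →+ N₂), K.Mem M → K.Mem N₁ → K.Mem N₂ → K.IsEmb f₁ → K.IsEmb f₂ →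
    ∃ (N : Type u) (_ : AddCommGroup N) (g₁ : N₁ →+ N) (g₂ : N₂ →+ N),
      K.Mem N ∧ K.IsEmb g₁ ∧ K.IsEmb g₂ ∧ ∀ m, g₁ (f₁ m) = g₂ (f₂ m)

/-- `cl_K^N(A)`: the intersection of all `M ≤_K N` (with `M` in `K`) that contain `A`. -/
def cl (N : Type u) [AddCommGroup N] (A : Set N) : AddSubgroup N :=
  sInf {M : AddSubgroup N | K.Mem M ∧ A ⊆ (M : Set N) ∧ K.Strong N M}

/-- `K` admits intersections. -/
def AdmitsIntersections : Prop :=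
  ∀ (N : Type u) [AddCommGroup N], K.Mem N → ∀ A : Set N,
    K.Mem (K.cl N A) ∧ K.Strong N (K.cl N A)

/-- The triples `(b, A, N)` with `N` in `K`, `A ⊆ |N|` and `b ∈ N`, for a fixed `A`. The inclusion
of `A` in `N` is recorded as an injection. -/
structure Triple (A : Type u) where
  /-- the model -/
  N : Type u
  /-- its group structure -/
  [grp : AddCommGroup N]
  mem : K.Mem N
  /-- the inclusion of the parameters -/
  incl : A ↪ N
  /-- the element whose type is considered -/
  b : N

attribute [instance] Triple.grp

variable {K}

/-- The atomic relation `E_at`: `N₁` and `N₂` have `K`-embeddings into a common member of `K`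
which agree on `A` and identify `b₁` with `b₂`. -/
def Eat {A : Type u} (s t : K.Triple A) : Prop :=
  ∃ (N : Type u) (_ : AddCommGroup N) (f₁ : s.N →+ N) (f₂ : t.N →+ N),
    K.Mem N ∧ K.IsEmb f₁ ∧ K.IsEmb f₂ ∧
      (∀ a, f₁ (s.incl a) = f₂ (t.incl a)) ∧ f₁ s.b = f₂ t.b

/-- The Galois type `gtp_K(b/A; N)`: the class of `(b, A, N)` under the transitive closure
of `E_at`. -/
def gtp {A : Type u} (s : K.Triple A) : Set (K.Triple A) :=
  {t | Relation.TransGen Eat s t}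

/-- The triple `(b, A₀, N)` obtained from `(b, A, N)` by passing to a subset `A₀ ⊆ A`. -/
def Triple.restrict {A : Type u} (s : K.Triple A) (A₀ : Set A) : K.Triple A₀ where
  N := s.N
  mem := s.mem
  incl := (Function.Embedding.subtype (· ∈ A₀)).trans s.incl
  b := s.b

/-- For a triple over a model `M`: the inclusion of `M` in `N` is a `K`-embedding, i.e.
`M ≤_K N`. -/
def Triple.IsStrong {M : Type u} [AddCommGroup M] (s : K.Triple M) : Prop :=
  ∃ f : M →+ s.N, (∀ m, f m = s.incl m) ∧ K.IsEmb f

variable (K)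

/-- `gS_K(M)`: the set of Galois types `gtp_K(b/M; N)` with `M ≤_K N` and `b ∈ N`. -/
def gS (M : Type u) [AddCommGroup M] : Set (Set (K.Triple M)) :=
  {p | ∃ s : K.Triple M, s.IsStrong ∧ gtp s = p}

/-- `(<μ, θ)`-tameness: distinct types over a model of size `θ` have distinct restrictions to some
parameter set of size less than `μ`. -/
def LtTameAt (μ θ : Cardinal.{u}) : Prop :=
  ∀ (M : Type u) [AddCommGroup M], K.Mem M → #M = θ →
    ∀ s t : K.Triple M, s.IsStrong → t.IsStrong → gtp s ≠ gtp t →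
      ∃ A : Set M, #A < μ ∧ gtp (s.restrict A) ≠ gtp (t.restrict A)

/-- `(<μ)`-tameness. -/
def LtTame (μ : Cardinal.{u}) : Prop :=
  ∀ θ : Cardinal.{u}, ℵ₀ ≤ θ → K.LtTameAt μ θ

/-- `μ`-tameness, i.e. `(<μ⁺)`-tameness. -/
def Tame (μ : Cardinal.{u}) : Prop := K.LtTame (Order.succ μ)

/-- Stability in `μ`: there are at most `μ` Galois types over every model of size `μ`. -/
def StableIn (μ : Cardinal.{u}) : Prop :=
  ∀ (M : Type u) [AddCommGroup M], K.Mem M → #M = μ → #(K.gS M) ≤ Cardinal.lift.{u + 1} μ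

end GroupClass

/-- `p^ω G`, the subgroup of the elements of `G` divisible by every power of `p`. -/
def pOmega (p : ℕ) (G : Type u) [AddCommGroup G] : AddSubgroup G where
  carrier := {g | ∀ n : ℕ, ∃ h : G, p ^ n • h = g}
  zero_mem' := fun _ => ⟨0, smul_zero _⟩
  add_mem' := by
    intro a b ha hb n
    obtain ⟨x, hx⟩ := ha n
    obtain ⟨y, hy⟩ := hb n
    exact ⟨x + y, by rw [smul_add, hx, hy]⟩
  neg_mem' := by
    intro a ha n
    obtain ⟨x, hx⟩ := ha n
    exact ⟨-x, by rw [smul_neg, hx]⟩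

/-- `H` is a pure subgroup of `G`: `nH = H ∩ nG` for all integers `n`. -/
def IsPureSubgroup {G : Type u} [AddCommGroup G] (H : AddSubgroup G) : Prop :=
  ∀ n : ℤ, {x : G | ∃ h ∈ H, n • h = x} = (H : Set G) ∩ {x : G | ∃ g : G, n • g = x}

/-- Membership in the class `K₁(p₁, p₂)`: torsion-free abelian groups `G` such that `p₁^ω G` and
`p₂^ω G` are countable. -/
def K1Mem (p₁ p₂ : ℕ) (G : Type u) [AddCommGroup G] : Prop :=
  IsAddTorsionFree G ∧ #(pOmega p₁ G) ≤ ℵ₀ ∧ #(pOmega p₂ G) ≤ ℵ₀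

/-- The class `K₁(p₁, p₂)` with its relation: for `G₁`, `G₂` in the class, `G₁ ≤ G₂` iff `G₁` is a
pure subgroup of `G₂`, `p₁^ω G₁ = p₁^ω G₂`, and either `G₁ = p₁^ω G₁` or `p₂^ω G₁ = p₂^ω G₂`. -/
def K1 (p₁ p₂ : ℕ) : GroupClass.{u} where
  Mem G _ := K1Mem p₁ p₂ G
  Strong G₂ _ G₁ := K1Mem p₁ p₂ G₁ ∧ K1Mem p₁ p₂ G₂ ∧ IsPureSubgroup G₁ ∧
    (pOmega p₁ G₁).map G₁.subtype = pOmega p₁ G₂ ∧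
    (pOmega p₁ G₁ = ⊤ ∨ (pOmega p₂ G₁).map G₁.subtype = pOmega p₂ G₂)

/-! ### Purity and infinitely divisible parts -/

section Pure

variable {G H : Type u} [AddCommGroup G] [AddCommGroup H]

/-! Write `Dᵢ(G)` for `pᵢ^ω G`. Inside a torsion-free `N`, purity means closure under division, so
`M ≤ N` says: `M` is division-closed, contains `D₁(N)`, and either equals `D₁(N)` or contains
`D₂(N)` (`K1_strong_iff`). The AEC axioms, the Löwenheim–Skolem number and intersections follow by
case analysis on this disjunction.

Everything else rests on a dichotomy. If `M` is not `p₁`-divisible, no extension changes `D₁` or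
`D₂`, and extensions of `M` are just pure extensions in which the two parts are frozen. A type of
`b` over `M` is then the set of relations "`n` divides `k b + m`": equal relations make the pure
closures of `M + ℤb` isomorphic (`K1_gtp_eq_of_zsmul_iff`). Each relation has one parameter, and an
`M` that is `p₁`-divisible is countable, hence `ℵ₀`-tameness. For each `(n, k)` a single `m`
determines all the others, hence at most `λ^ℵ₀` types when `λ` is uncountable. Conversely, 2-adic
sums along the branches of a tree give `λ^ℵ₀` types over a free group.

If `M` is `p₁`-divisible, an extension may enlarge `D₂`, and does so in incompatible ways; this
breaks amalgamation over `0`. It also breaks finite tameness: once `b` is not `p₁`-divisible, its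
type fixes `D₂`, and can thus express that `D₂` contains a `q`-adic limit of a sequence in `M`. In
the groups `twistedGroup` with `c = 0` and `c = 1/p₁` such a limit respectively exists and does not.
Finitely many parameters see the sequence only modulo `q ^ r`, where `1/p₁` agrees with an integer,
and a shear identifies the two types. -/

theorem map_mem_pOmega {p : ℕ} (f : G →+ H) {x : G} (hx : x ∈ pOmega p G) :
    f x ∈ pOmega p H := fun n => by
  obtain ⟨h, hh⟩ := hx n
  exact ⟨f h, by rw [← map_nsmul, hh]⟩

/-- `M` is closed under division by nonzero integers in the ambient group. -/
def AddSubgroup.IsDivClosed (M : AddSubgroup G) : Prop :=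
  ∀ (n : ℤ) (g : G), n ≠ 0 → n • g ∈ M → g ∈ M

theorem isPureSubgroup_iff [IsAddTorsionFree G] (M : AddSubgroup G) :
    IsPureSubgroup M ↔ M.IsDivClosed := by
  constructor
  · intro h n g hn hg
    obtain ⟨k, hk, hkg⟩ := (h n).ge ⟨hg, g, rfl⟩
    exact (zsmul_right_injective hn hkg : k = g) ▸ hk
  · intro h n
    ext x
    constructor
    · rintro ⟨k, hk, rfl⟩
      exact ⟨M.zsmul_mem hk n, k, rfl⟩
    · rintro ⟨hx, g, rfl⟩
      by_cases hn : n = 0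
      · exact ⟨0, M.zero_mem, by simp [hn]⟩
      · exact ⟨g, h n g hn hx, rfl⟩

theorem AddSubgroup.IsDivClosed.of_nsmul {M : AddSubgroup G} (h : M.IsDivClosed) {n : ℕ} (hn : n ≠ 0)
    {g : G} (hg : n • g ∈ M) : g ∈ M :=
  h n g (by exact_mod_cast hn) (by simpa using hg)

theorem map_pOmega_of_isDivClosed {M : AddSubgroup G} (h : M.IsDivClosed) {p : ℕ} (hp : p ≠ 0) :
    (pOmega p M).map M.subtype = M ⊓ pOmega p G := by
  ext x
  constructor
  · rintro ⟨y, hy, rfl⟩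
    exact ⟨y.2, map_mem_pOmega M.subtype hy⟩
  · rintro ⟨hx, hx'⟩
    refine ⟨⟨x, hx⟩, fun n => ?_, rfl⟩
    obtain ⟨g, hg⟩ := hx' n
    exact ⟨⟨g, h.of_nsmul (pow_ne_zero n hp) (hg ▸ hx)⟩, Subtype.ext (by simpa using hg)⟩

/-- With `n = p ^ a * m` and `m` prime to `p`, torsion-freeness cancels `p ^ a`, and Bézout for `m`
and `p ^ k` turns divisibility of `m • g` into divisibility of `g`. -/
theorem isDivClosed_pOmega [IsAddTorsionFree G] {p : ℕ} (hp : p.Prime) :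
    (pOmega p G).IsDivClosed := by
  intro n g hn hg k
  obtain ⟨a, m, hm, hnm⟩ :=
    Nat.exists_eq_pow_mul_and_not_dvd (Int.natAbs_ne_zero.mpr hn) p hp.ne_one
  have hg' : n.natAbs • g ∈ pOmega p G := by
    rcases Int.natAbs_eq n with h | h
    · rwa [← natCast_zsmul, ← h]
    · rw [← natCast_zsmul, ← neg_mem_iff, ← neg_zsmul, ← h]
      exact hg
  obtain ⟨h, hh⟩ := hg' (a + k)
  have hmg : m • g = p ^ k • h := by
    apply IsAddTorsionFree.nsmul_right_injective (pow_ne_zero a hp.ne_zero)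
    simp only [smul_smul, ← hnm, ← pow_add, hh]
  have hc : IsCoprime (m : ℤ) ((p ^ k : ℕ) : ℤ) :=
    Nat.isCoprime_iff_coprime.mpr
      (((Nat.Prime.coprime_iff_not_dvd hp).mpr hm).symm.pow_right k)
  obtain ⟨u, v, huv⟩ := hc
  refine ⟨u • h + v • g, ?_⟩
  calc p ^ k • (u • h + v • g) = u • (p ^ k • h) + (v * ((p ^ k : ℕ) : ℤ)) • g := by
        rw [smul_add, smul_comm, mul_comm v, mul_zsmul, natCast_zsmul]
    _ = (u * m + v * ((p ^ k : ℕ) : ℤ)) • g := by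
        simp only [← hmg, add_zsmul, mul_zsmul, natCast_zsmul]
    _ = g := by rw [huv, one_zsmul]

theorem AddSubgroup.IsDivClosed.sInf {S : Set (AddSubgroup G)} (h : ∀ M ∈ S, M.IsDivClosed) :
    (sInf S).IsDivClosed := fun n g hn hg => by
  rw [AddSubgroup.mem_sInf] at hg ⊢
  exact fun M hM => h M hM n g hn (hg M hM)

/-- The set of the elements of `G` that have a nonzero multiple in `M`. -/
def AddSubgroup.divClosure (M : AddSubgroup G) : AddSubgroup G where
  carrier := {x | ∃ n : ℤ, n ≠ 0 ∧ n • x ∈ M}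
  zero_mem' := ⟨1, one_ne_zero, by simp⟩
  add_mem' := by
    rintro x y ⟨n, hn, hx⟩ ⟨m, hm, hy⟩
    refine ⟨n * m, mul_ne_zero hn hm, ?_⟩
    rw [smul_add, mul_comm, mul_zsmul, mul_comm, mul_zsmul]
    exact add_mem (M.zsmul_mem hx m) (M.zsmul_mem hy n)
  neg_mem' := by
    rintro x ⟨n, hn, hx⟩
    exact ⟨n, hn, by rwa [smul_neg, neg_mem_iff]⟩

theorem AddSubgroup.isDivClosed_divClosure (M : AddSubgroup G) : M.divClosure.IsDivClosed := by
  rintro n g hn ⟨m, hm, h⟩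
  exact ⟨m * n, mul_ne_zero hm hn, by rwa [mul_zsmul]⟩

theorem AddSubgroup.le_divClosure (M : AddSubgroup G) : M ≤ M.divClosure :=
  fun x hx => ⟨1, one_ne_zero, by simpa using hx⟩

/-- By torsion-freeness `x` is determined by some `n ≠ 0` and an integer combination of `S` equal to
`n • x`. -/
theorem mk_divClosure_closure_le [IsAddTorsionFree G] (S : Set G) :
    #(AddSubgroup.closure S).divClosure ≤ max #S ℵ₀ := by
  have hspan : ∀ x ∈ AddSubgroup.closure S,
      ∃ l : S →₀ ℤ, Finsupp.linearCombination ℤ (Subtype.val : S → G) l = x := by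
    intro x hx
    rw [← Submodule.span_int_eq_addSubgroupClosure] at hx
    exact (Finsupp.mem_span_iff_linearCombination ℤ S x).mp hx
  have key : ∀ x : (AddSubgroup.closure S).divClosure, ∃ nl : ℤ × (S →₀ ℤ), nl.1 ≠ 0 ∧
      Finsupp.linearCombination ℤ (Subtype.val : S → G) nl.2 = nl.1 • x.1 := by
    rintro ⟨x, n, hn, hx⟩
    obtain ⟨l, hl⟩ := hspan _ hx
    exact ⟨(n, l), hn, hl⟩
  choose F hF0 hF using key
  have hinj : Function.Injective F := by
    intro x y hxy
    have h := hF x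
    rw [hxy, hF y] at h
    exact Subtype.ext (zsmul_right_injective (hF0 y) h).symm
  have h1 := Cardinal.mk_le_of_injective hinj
  refine h1.trans ?_
  have h2 : #(S →₀ ℤ) ≤ max #S ℵ₀ := by
    rcases finite_or_infinite S with hS | hS
    · exact (Cardinal.mk_le_aleph0 (α := S →₀ ℤ)).trans (le_max_right _ _)
    · have := Cardinal.mk_finsupp_lift_of_infinite S ℤ
      simp [this]
  rw [Cardinal.mk_prod]
  refine (Cardinal.mul_le_max _ _).trans ?_
  simp only [Cardinal.mk_int, Cardinal.lift_aleph0, Cardinal.lift_uzero]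
  exact max_le (max_le (le_max_right _ _) h2) (le_max_right _ _)

end Pure

/-! ### Members of the class and the strong submodel relation -/

section Membership

variable {p₁ p₂ : ℕ} {G H : Type u} [AddCommGroup G] [AddCommGroup H]

theorem pOmega_countable_of_injective {p : ℕ} (f : G →+ H) (hf : Function.Injective f)
    (h : #(pOmega p H) ≤ ℵ₀) : #(pOmega p G) ≤ ℵ₀ := by
  refine (Cardinal.mk_le_of_injective (f := fun x : pOmega p G =>
    (⟨f x.1, map_mem_pOmega f x.2⟩ : pOmega p H)) ?_).trans h
  intro x y hxy
  exact Subtype.ext (hf (congrArg Subtype.val hxy))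

theorem K1Mem.of_injective (h : K1Mem p₁ p₂ H) (f : G →+ H) (hf : Function.Injective f) :
    K1Mem p₁ p₂ G := by
  have := h.1
  exact ⟨hf.isAddTorsionFree f, pOmega_countable_of_injective f hf h.2.1,
    pOmega_countable_of_injective f hf h.2.2⟩

theorem K1Mem.addSubgroup (h : K1Mem p₁ p₂ H) (M : AddSubgroup H) : K1Mem p₁ p₂ M :=
  h.of_injective M.subtype M.subtype_injective

theorem K1_strong_iff (hp₁ : p₁.Prime) (hp₂ : p₂.Prime) {N : Type u} [AddCommGroup N]
    (M : AddSubgroup N) :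
    (K1 p₁ p₂).Strong N M ↔ K1Mem p₁ p₂ N ∧ M.IsDivClosed ∧ pOmega p₁ N ≤ M ∧
      (M ≤ pOmega p₁ N ∨ pOmega p₂ N ≤ M) := by
  have htop (h : M.IsDivClosed) : pOmega p₁ M = ⊤ ↔ M ≤ pOmega p₁ N := by
    rw [← inf_eq_left, ← map_pOmega_of_isDivClosed h hp₁.ne_zero]
    constructor
    · intro h
      rw [h, ← AddMonoidHom.range_eq_map, AddSubgroup.range_subtype]
    · intro h
      rw [eq_top_iff]
      intro x _
      obtain ⟨y, hy, hyx⟩ := h.ge x.2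
      rwa [← show y = x from Subtype.ext hyx]
  constructor
  · rintro ⟨-, hN, hpure, h₁, h₂⟩
    have := hN.1
    rw [isPureSubgroup_iff] at hpure
    rw [map_pOmega_of_isDivClosed hpure hp₁.ne_zero, inf_eq_right] at h₁
    rw [map_pOmega_of_isDivClosed hpure hp₂.ne_zero, inf_eq_right, htop hpure] at h₂
    exact ⟨hN, hpure, h₁, h₂⟩
  · rintro ⟨hN, hpure, h₁, h₂⟩
    have := hN.1
    refine ⟨hN.addSubgroup M, hN, (isPureSubgroup_iff M).mpr hpure, ?_, ?_⟩
    · rwa [map_pOmega_of_isDivClosed hpure hp₁.ne_zero, inf_eq_right]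
    · rwa [map_pOmega_of_isDivClosed hpure hp₂.ne_zero, inf_eq_right, htop hpure]

end Membership

/-! ### The AEC axioms, the Löwenheim–Skolem number and intersections -/

section AEC

variable {p₁ p₂ : ℕ}

/-- `p^ω N` as a subgroup of the ambient group `U`. -/
def AddSubgroup.divPart {U : Type u} [AddCommGroup U] (p : ℕ) (N : AddSubgroup U) : AddSubgroup U :=
  (pOmega p N).map N.subtype

section divPart

variable {U : Type u} [AddCommGroup U] {p : ℕ} {M N : AddSubgroup U}

theorem AddSubgroup.mem_divPart {x : U} :
    x ∈ N.divPart p ↔ x ∈ N ∧ ∀ n : ℕ, ∃ h ∈ N, p ^ n • h = x := by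
  constructor
  · rintro ⟨y, hy, rfl⟩
    refine ⟨y.2, fun n => ?_⟩
    obtain ⟨h, hh⟩ := hy n
    exact ⟨h, h.2, congrArg Subtype.val hh⟩
  · rintro ⟨hx, h⟩
    refine ⟨⟨x, hx⟩, fun n => ?_, rfl⟩
    obtain ⟨h, hN, hh⟩ := h n
    exact ⟨⟨h, hN⟩, Subtype.ext hh⟩

theorem AddSubgroup.divPart_le : N.divPart p ≤ N := fun _ hx => (AddSubgroup.mem_divPart.mp hx).1

theorem AddSubgroup.divPart_mono (h : M ≤ N) : M.divPart p ≤ N.divPart p := fun x hx => by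
  rw [AddSubgroup.mem_divPart] at hx ⊢
  refine ⟨h hx.1, fun n => ?_⟩
  obtain ⟨y, hy, hyx⟩ := hx.2 n
  exact ⟨y, h hy, hyx⟩

/-- `M` is closed in `N` under division by nonzero integers. -/
def AddSubgroup.IsDivClosedIn (M N : AddSubgroup U) : Prop :=
  ∀ (n : ℤ), n ≠ 0 → ∀ g ∈ N, n • g ∈ M → g ∈ M

theorem AddSubgroup.IsDivClosedIn.divPart (h : M.IsDivClosedIn N) (hp : p ≠ 0) {x : U} (hx : x ∈ M)
    (hx' : x ∈ N.divPart p) : x ∈ M.divPart p := by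
  rw [AddSubgroup.mem_divPart] at hx' ⊢
  refine ⟨hx, fun n => ?_⟩
  obtain ⟨y, hy, rfl⟩ := hx'.2 n
  refine ⟨y, h ((p ^ n : ℕ) : ℤ) (by exact_mod_cast pow_ne_zero n hp) y hy ?_, rfl⟩
  rwa [natCast_zsmul]

theorem AddSubgroup.mk_divPart : #(N.divPart p) = #(pOmega p N) :=
  Cardinal.mk_image_eq N.subtype_injective

theorem AddSubgroup.addSubgroupOf_le_pOmega :
    M.addSubgroupOf N ≤ pOmega p N ↔ M ⊓ N ≤ N.divPart p := by
  constructor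
  · rintro h x ⟨hx, hx'⟩
    exact ⟨⟨x, hx'⟩, h (show (⟨x, hx'⟩ : N) ∈ M.addSubgroupOf N from hx), rfl⟩
  · intro h x hx
    obtain ⟨y, hy, hyx⟩ := h ⟨hx, x.2⟩
    rwa [← show y = x from Subtype.ext hyx]

theorem AddSubgroup.pOmega_le_addSubgroupOf :
    pOmega p N ≤ M.addSubgroupOf N ↔ N.divPart p ≤ M :=
  (AddSubgroup.map_le_iff_le_comap).symm

theorem AddSubgroup.isDivClosed_addSubgroupOf :
    (M.addSubgroupOf N).IsDivClosed ↔ M.IsDivClosedIn N := by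
  constructor
  · intro h n hn g hg hM
    exact h n ⟨g, hg⟩ hn hM
  · intro h n g hn hM
    exact h n hn g g.2 hM

theorem K1_le_iff (hp₁ : p₁.Prime) (hp₂ : p₂.Prime) :
    (K1 p₁ p₂).Le M N ↔ M ≤ N ∧ K1Mem p₁ p₂ N ∧ M.IsDivClosedIn N ∧ N.divPart p₁ ≤ M ∧
      (M ≤ N.divPart p₁ ∨ N.divPart p₂ ≤ M) := by
  unfold GroupClass.Le
  rw [K1_strong_iff hp₁ hp₂, AddSubgroup.isDivClosed_addSubgroupOf,
    AddSubgroup.pOmega_le_addSubgroupOf, AddSubgroup.pOmega_le_addSubgroupOf,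
    AddSubgroup.addSubgroupOf_le_pOmega]
  refine and_congr_right fun h => ?_
  rw [inf_eq_left.mpr h]

end divPart

theorem pOmega_map_equiv {p : ℕ} {N N' : Type u} [AddCommGroup N] [AddCommGroup N'] (f : N ≃+ N')
    {x : N} : f x ∈ pOmega p N' ↔ x ∈ pOmega p N := by
  constructor
  · intro h
    simpa using map_mem_pOmega f.symm.toAddMonoidHom h
  · exact fun h => map_mem_pOmega f.toAddMonoidHom h

theorem K1_strong_map_equiv (hp₁ : p₁.Prime) (hp₂ : p₂.Prime) {N N' : Type u} [AddCommGroup N]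
    [AddCommGroup N'] (f : N ≃+ N') {M : AddSubgroup N} (h : (K1 p₁ p₂).Strong N M) :
    (K1 p₁ p₂).Strong N' (M.map f.toAddMonoidHom) := by
  rw [K1_strong_iff hp₁ hp₂] at h ⊢
  obtain ⟨hN, hpure, h₁, h₂⟩ := h
  have hmem (y : N') : y ∈ M.map f.toAddMonoidHom ↔ f.symm y ∈ M :=
    AddSubgroup.mem_map_equiv (f := f)
  have hD (p : ℕ) (y : N') : f.symm y ∈ pOmega p N ↔ y ∈ pOmega p N' := pOmega_map_equiv f.symm
  refine ⟨hN.of_injective f.symm.toAddMonoidHom f.symm.injective, ?_, ?_, ?_⟩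
  · intro n g hn hg
    rw [hmem] at hg ⊢
    exact hpure n _ hn (by simpa using hg)
  · intro y hy
    rw [hmem]
    exact h₁ ((hD _ _).mpr hy)
  · refine h₂.imp (fun h y hy => ?_) (fun h y hy => ?_)
    · exact (hD _ _).mp (h ((hmem y).mp hy))
    · exact (hmem y).mpr (h ((hD _ _).mpr hy))

theorem K1_strong_trans (hp₁ : p₁.Prime) (hp₂ : p₂.Prime) {N : Type u} [AddCommGroup N]
    {M₀ M₁ : AddSubgroup N} (h₀ : (K1 p₁ p₂).Le M₀ M₁) (h₁ : (K1 p₁ p₂).Strong N M₁) :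
    (K1 p₁ p₂).Strong N M₀ := by
  rw [K1_le_iff hp₁ hp₂] at h₀
  rw [K1_strong_iff hp₁ hp₂] at h₁ ⊢
  obtain ⟨hle, -, hpure₀, hD₀, hE₀⟩ := h₀
  obtain ⟨hN, hpure₁, hD₁, hE₁⟩ := h₁
  have hD {p : ℕ} (hp : p ≠ 0) (h : pOmega p N ≤ M₁) : pOmega p N ≤ M₁.divPart p := by
    rw [AddSubgroup.divPart, map_pOmega_of_isDivClosed hpure₁ hp]
    exact le_inf h le_rfl
  have hD' (p : ℕ) : M₁.divPart p ≤ pOmega p N := by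
    rintro _ ⟨y, hy, rfl⟩
    exact map_mem_pOmega M₁.subtype hy
  refine ⟨hN, fun n g hn hg => hpure₀ n hn g (hpure₁ n g hn (hle hg)) hg,
    (hD hp₁.ne_zero hD₁).trans hD₀, ?_⟩
  rcases hE₀ with h | h
  · exact Or.inl (h.trans (hD' _))
  rcases hE₁ with h' | h'
  · exact Or.inl (hle.trans h')
  · exact Or.inr ((hD hp₂.ne_zero h').trans h)

theorem K1_coherence (hp₁ : p₁.Prime) (hp₂ : p₂.Prime) {N : Type u} [AddCommGroup N]
    {M₀ M₁ : AddSubgroup N} (h₀ : (K1 p₁ p₂).Strong N M₀) (h₁ : (K1 p₁ p₂).Strong N M₁)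
    (hle : M₀ ≤ M₁) : (K1 p₁ p₂).Le M₀ M₁ := by
  rw [K1_le_iff hp₁ hp₂]
  rw [K1_strong_iff hp₁ hp₂] at h₀ h₁
  obtain ⟨hN, hpure₀, hD₀, hE₀⟩ := h₀
  obtain ⟨-, hpure₁, hD₁, hE₁⟩ := h₁
  have hD {p : ℕ} (hp : p ≠ 0) : M₁.divPart p = M₁ ⊓ pOmega p N :=
    map_pOmega_of_isDivClosed hpure₁ hp
  rw [hD hp₁.ne_zero, hD hp₂.ne_zero]
  exact ⟨hle, hN.addSubgroup M₁, fun n hn g _ hg => hpure₀ n g hn hg, inf_le_right.trans hD₀,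
    hE₀.imp (fun h => le_inf hle h) inf_le_right.trans⟩

/-- The `p₁`-part is constant along the chain. The `p₂`-part can grow only while the members are
`p₁`-divisible, and all such members lie in that constant part; so both parts of the union already
lie in single members, which keeps them countable. -/
theorem K1_chain (hp₁ : p₁.Prime) (hp₂ : p₂.Prime) {U : Type u} [AddCommGroup U] {ι : Type*}
    [LinearOrder ι] [Nonempty ι] (M : ι → AddSubgroup U) (hmem : ∀ i, K1Mem p₁ p₂ (M i))
    (hle : ∀ i j, i ≤ j → (K1 p₁ p₂).Le (M i) (M j)) (M' : AddSubgroup U)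
    (hM' : (M' : Set U) = ⋃ i, (M i : Set U)) :
    K1Mem p₁ p₂ M' ∧ (∀ i, (K1 p₁ p₂).Le (M i) M') ∧
      ∀ N : AddSubgroup U, K1Mem p₁ p₂ N → (∀ i, (K1 p₁ p₂).Le (M i) N) →
        (K1 p₁ p₂).Le M' N := by
  simp only [K1_le_iff hp₁ hp₂] at hle ⊢
  have hmem' (x : U) : x ∈ M' ↔ ∃ i, x ∈ M i := by
    rw [← SetLike.mem_coe, hM']
    simp
  have hsub (i) : M i ≤ M' := fun x hx => (hmem' x).mpr ⟨i, hx⟩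
  have hpure (i) : (M i).IsDivClosedIn M' := by
    intro n hn g hg hng
    obtain ⟨j, hj⟩ := (hmem' g).mp hg
    rcases le_total i j with h | h
    · exact (hle i j h).2.2.1 n hn g hj hng
    · exact (hle j i h).1 hj
  have hdiv {p : ℕ} (hp : p ≠ 0) {x : U} (hx : x ∈ M'.divPart p) (i₀) :
      ∃ i, i₀ ≤ i ∧ x ∈ (M i).divPart p := by
    obtain ⟨j, hj⟩ := (hmem' x).mp (AddSubgroup.divPart_le hx)
    exact ⟨max i₀ j, le_max_left _ _,
      (hpure _).divPart hp ((hle j _ (le_max_right _ _)).1 hj) hx⟩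
  -- the `p`-part stabilises as soon as it is contained in some member of the chain
  have hstab {p : ℕ} (hp : p ≠ 0) (i₀) (h : ∀ i, i₀ ≤ i → (M i).divPart p ≤ M i₀) :
      M'.divPart p ≤ M i₀ := fun x hx => by
    obtain ⟨i, hi, hxi⟩ := hdiv hp hx i₀
    exact h i hi hxi
  have hD₁ (i) : M'.divPart p₁ ≤ M i :=
    hstab hp₁.ne_zero i fun j hj => (hle i j hj).2.2.2.1
  have hcount {p : ℕ} (hp : p ≠ 0) (i₀) (h : M'.divPart p ≤ M i₀) (h' : #(pOmega p (M i₀)) ≤ ℵ₀) :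
      #(pOmega p M') ≤ ℵ₀ := by
    rw [← AddSubgroup.mk_divPart] at h' ⊢
    exact (Cardinal.mk_le_mk_of_subset
      fun x hx => (hpure i₀).divPart hp (h hx) hx).trans h'
  have hcases : (∃ i, M'.divPart p₂ ≤ M i) ∧
      (∀ i, M i ≤ M'.divPart p₁ ∨ M'.divPart p₂ ≤ M i) := by
    have h1 (i) (h : ¬ M i ≤ M'.divPart p₁) : M'.divPart p₂ ≤ M i := by
      refine hstab hp₂.ne_zero i fun j hj => ?_
      rcases (hle i j hj).2.2.2.2 with h' | h'
      · exact absurd (h'.trans (AddSubgroup.divPart_mono (hsub j))) h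
      · exact h'
    refine ⟨?_, fun i => or_iff_not_imp_left.mpr (h1 i)⟩
    -- A `p₂`-divisible `x` outside `M i₀` lies in some `M j`; as `x` is not in the `p₁`-part, `M j`
    -- contains the whole `p₂`-part.
    by_contra! hcon
    have i₀ : ι := Classical.arbitrary ι
    apply hcon i₀
    intro x hx
    obtain ⟨j, hj⟩ := (hmem' x).mp (AddSubgroup.divPart_le hx)
    by_contra hxi
    exact hcon j (h1 j fun h => hxi (hD₁ i₀ (h hj)))
  obtain ⟨⟨i₂, hi₂⟩, hcases⟩ := hcases
  have i₀ : ι := Classical.arbitrary ι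
  have hK : K1Mem p₁ p₂ M' := by
    refine ⟨⟨fun n hn x y hxy => ?_⟩, hcount hp₁.ne_zero i₀ (hD₁ i₀) (hmem i₀).2.1,
      hcount hp₂.ne_zero i₂ hi₂ (hmem i₂).2.2⟩
    obtain ⟨i, hi⟩ := (hmem' x).mp x.2
    obtain ⟨j, hj⟩ := (hmem' y).mp y.2
    have := (hmem (max i j)).1
    have hxy' := congrArg Subtype.val hxy
    have := IsAddTorsionFree.nsmul_right_injective hn
      (a₁ := (⟨x, (hle i _ (le_max_left i j)).1 hi⟩ : M (max i j)))
      (a₂ := ⟨y, (hle j _ (le_max_right i j)).1 hj⟩) (Subtype.ext hxy')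
    exact Subtype.ext (congrArg Subtype.val this :)
  refine ⟨hK, fun i => ⟨hsub i, hK, hpure i, hD₁ i, hcases i⟩, fun N hN hMN => ?_⟩
  refine ⟨fun x hx => ?_, hN, fun n hn g hg hng => ?_, (hMN i₀).2.2.2.1.trans (hsub i₀), ?_⟩
  · obtain ⟨i, hi⟩ := (hmem' x).mp hx
    exact (hMN i).1 hi
  · obtain ⟨i, hi⟩ := (hmem' _).mp hng
    exact hsub i ((hMN i).2.2.1 n hn g hg hi)
  · by_cases h : ∃ i, N.divPart p₂ ≤ M i
    · obtain ⟨i, hi⟩ := h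
      exact Or.inr (hi.trans (hsub i))
    · refine Or.inl fun x hx => ?_
      obtain ⟨i, hi⟩ := (hmem' x).mp hx
      exact ((hMN i).2.2.2.2.resolve_right fun h' => h ⟨i, h'⟩) hi

theorem K1_isLSCardinal_aleph0 (hp₁ : p₁.Prime) (hp₂ : p₂.Prime) :
    (K1.{u} p₁ p₂).IsLSCardinal ℵ₀ := by
  refine ⟨le_rfl, fun M _ hM A => ?_⟩
  have := hM.1
  let S : Set M := A ∪ (pOmega p₁ M ∪ pOmega p₂ M)
  -- Adding both divisible parts to `A` costs only `ℵ₀` elements and secures the second alternative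
  -- of the relation.
  have hS : S ⊆ (AddSubgroup.closure S).divClosure :=
    fun x hx => AddSubgroup.le_divClosure _ (AddSubgroup.subset_closure hx)
  refine ⟨(AddSubgroup.closure S).divClosure, ?_, Set.subset_union_left.trans hS, ?_⟩
  · rw [K1_strong_iff hp₁ hp₂]
    exact ⟨hM, AddSubgroup.isDivClosed_divClosure _,
      fun x hx => hS (Or.inr (Or.inl hx)), Or.inr fun x hx => hS (Or.inr (Or.inr hx))⟩
  · refine (mk_divClosure_closure_le S).trans (max_le ?_ (self_le_add_left _ _))
    have h : #(↑(pOmega p₁ M) ∪ ↑(pOmega p₂ M) : Set M) ≤ ℵ₀ :=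
      (Cardinal.mk_union_le _ _).trans
        ((add_le_add hM.2.1 hM.2.2).trans (by simp))
    exact (Cardinal.mk_union_le _ _).trans (by gcongr)

theorem K1_isAEC (hp₁ : p₁.Prime) (hp₂ : p₂.Prime) : (K1.{u} p₁ p₂).IsAEC where
  mem_of_strong _ _ _ h := ⟨h.1, h.2.1⟩
  refl N _ hN := (K1_strong_iff hp₁ hp₂ _).mpr
    ⟨hN, fun _ _ _ _ => AddSubgroup.mem_top _, le_top, Or.inr le_top⟩
  trans _ _ _ _ h₀ h₁ := K1_strong_trans hp₁ hp₂ h₀ h₁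
  mem_iso _ _ _ _ f hN := hN.of_injective f.symm.toAddMonoidHom f.symm.injective
  strong_iso _ _ _ _ f _ h := K1_strong_map_equiv hp₁ hp₂ f h
  coherence _ _ _ _ h₀ h₁ h := K1_coherence hp₁ hp₂ h₀ h₁ h
  chain U _ δ hδ M hmem hle M' hM' := by
    have : Nonempty (Set.Iio δ) := ⟨⟨0, hδ.bot_lt⟩⟩
    exact K1_chain hp₁ hp₂ M hmem hle M' hM'
  lst := ⟨ℵ₀, K1_isLSCardinal_aleph0 hp₁ hp₂⟩

theorem K1_LS (hp₁ : p₁.Prime) (hp₂ : p₂.Prime) : (K1.{u} p₁ p₂).LS = ℵ₀ :=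
  le_antisymm (csInf_le' (K1_isLSCardinal_aleph0 hp₁ hp₂))
    (le_csInf ⟨_, K1_isLSCardinal_aleph0 hp₁ hp₂⟩ fun _ h => h.1)

theorem K1_admitsIntersections (hp₁ : p₁.Prime) (hp₂ : p₂.Prime) :
    (K1.{u} p₁ p₂).AdmitsIntersections := by
  intro N _ hN A
  have := hN.1
  refine ⟨hN.addSubgroup _, ?_⟩
  rw [K1_strong_iff hp₁ hp₂]
  have hS {M : AddSubgroup N} (hM : (K1 p₁ p₂).Mem M ∧ A ⊆ M ∧ (K1 p₁ p₂).Strong N M) :=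
    (K1_strong_iff hp₁ hp₂ M).mp hM.2.2
  refine ⟨hN, AddSubgroup.IsDivClosed.sInf fun M hM => (hS hM).2.1,
    le_sInf fun M hM => (hS hM).2.2.1, ?_⟩
  -- If `A` lies in the `p₁`-part, that part is itself one of the intersected models; otherwise
  -- every one of them contains the `p₂`-part.
  by_cases hA : A ⊆ pOmega p₁ N
  · refine Or.inl (sInf_le ⟨hN.addSubgroup _, hA, ?_⟩)
    rw [K1_strong_iff hp₁ hp₂]
    exact ⟨hN, isDivClosed_pOmega hp₁, le_rfl, Or.inl le_rfl⟩
  · exact Or.inr (le_sInf fun M hM =>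
      (hS hM).2.2.2.resolve_left fun h => hA (hM.2.1.trans h))

end AEC

/-! ### Embeddings preserve and reflect divisibility -/

section Embeddings

variable {p₁ p₂ : ℕ}

theorem K1_isEmb_iff (hp₁ : p₁.Prime) (hp₂ : p₂.Prime) {M N : Type u} [AddCommGroup M]
    [AddCommGroup N] (f : M →+ N) :
    (K1 p₁ p₂).IsEmb f ↔ Function.Injective f ∧ K1Mem p₁ p₂ N ∧ f.range.IsDivClosed ∧
      pOmega p₁ N ≤ f.range ∧ (f.range ≤ pOmega p₁ N ∨ pOmega p₂ N ≤ f.range) := by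
  rw [GroupClass.IsEmb, K1_strong_iff hp₁ hp₂]

variable {M N : Type u} [AddCommGroup M] [AddCommGroup N] {f : M →+ N}

theorem K1_isEmb_zsmul_iff (hp₁ : p₁.Prime) (hp₂ : p₂.Prime) (hf : (K1 p₁ p₂).IsEmb f) {n : ℤ}
    {x : M} : (∃ y, n • y = f x) ↔ ∃ y, n • y = x := by
  obtain ⟨hinj, -, hpure, -⟩ := (K1_isEmb_iff hp₁ hp₂ f).mp hf
  constructor
  · rintro ⟨y, hy⟩
    by_cases hn : n = 0
    · refine ⟨0, hinj ?_⟩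
      rw [← hy, hn]
      simp
    · obtain ⟨z, rfl⟩ := hpure n y hn (hy ▸ ⟨x, rfl⟩)
      exact ⟨z, hinj (by rw [map_zsmul, hy])⟩
  · rintro ⟨y, rfl⟩
    exact ⟨f y, (map_zsmul f n y).symm⟩

theorem K1_isEmb_mem_pOmega_iff (hp₁ : p₁.Prime) (hp₂ : p₂.Prime) (hf : (K1 p₁ p₂).IsEmb f) {p : ℕ}
    {x : M} : f x ∈ pOmega p N ↔ x ∈ pOmega p M := by
  refine forall_congr' fun n => ?_
  have := K1_isEmb_zsmul_iff hp₁ hp₂ hf (n := (p ^ n : ℕ)) (x := x)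
  simpa only [natCast_zsmul] using this

/-- The freezing principle: one element outside the `p₁`-part excludes the first alternative, so an
extension adds no `p₂`-divisible elements. -/
theorem K1_isEmb_pOmega_le (hp₁ : p₁.Prime) (hp₂ : p₂.Prime) (hf : (K1 p₁ p₂).IsEmb f) {x : M}
    (hx : x ∉ pOmega p₁ M) : pOmega p₂ N ≤ f.range :=
  ((K1_isEmb_iff hp₁ hp₂ f).mp hf).2.2.2.2.resolve_left fun h =>
    hx ((K1_isEmb_mem_pOmega_iff hp₁ hp₂ hf).mp (h ⟨x, rfl⟩))

theorem K1_isEmb_addEquiv (hp₁ : p₁.Prime) (hp₂ : p₂.Prime) (hN : K1Mem p₁ p₂ N) (e : M ≃+ N) :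
    (K1 p₁ p₂).IsEmb e.toAddMonoidHom := by
  have : e.toAddMonoidHom.range = ⊤ := AddMonoidHom.range_eq_top.mpr e.surjective
  rw [K1_isEmb_iff hp₁ hp₂, this]
  exact ⟨e.injective, hN, fun _ _ _ _ => AddSubgroup.mem_top _, le_top, Or.inr le_top⟩

theorem K1_isEmb_id (hp₁ : p₁.Prime) (hp₂ : p₂.Prime) (hN : K1Mem p₁ p₂ N) :
    (K1 p₁ p₂).IsEmb (AddMonoidHom.id N) :=
  K1_isEmb_addEquiv hp₁ hp₂ hN (AddEquiv.refl N)

theorem K1_isEmb_of_pOmega_eq_bot (hp₁ : p₁.Prime) (hp₂ : p₂.Prime) (hN : K1Mem p₁ p₂ N)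
    (hf : Function.Injective f) (hpure : f.range.IsDivClosed) (h₁ : pOmega p₁ N = ⊥)
    (h₂ : pOmega p₂ N = ⊥) : (K1 p₁ p₂).IsEmb f := by
  rw [K1_isEmb_iff hp₁ hp₂, h₁, h₂]
  exact ⟨hf, hN, hpure, bot_le, Or.inr bot_le⟩

end Embeddings

/-! ### Galois types and divisibility relations -/

section Types

open GroupClass

variable {p₁ p₂ : ℕ} {A : Type u}

theorem GroupClass.Eat.symm {K : GroupClass.{u}} {s t : K.Triple A} (h : Eat s t) : Eat t s := by
  obtain ⟨N, _, f, g, hN, hf, hg, hA, hb⟩ := h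
  exact ⟨N, _, g, f, hN, hg, hf, fun a => (hA a).symm, hb.symm⟩

theorem K1_Eat_refl (hp₁ : p₁.Prime) (hp₂ : p₂.Prime) (s : (K1.{u} p₁ p₂).Triple A) : Eat s s :=
  ⟨s.N, _, .id _, .id _, s.mem, K1_isEmb_id hp₁ hp₂ s.mem, K1_isEmb_id hp₁ hp₂ s.mem,
    fun _ => rfl, rfl⟩

theorem K1_gtp_eq_iff (hp₁ : p₁.Prime) (hp₂ : p₂.Prime) {s t : (K1.{u} p₁ p₂).Triple A} :
    gtp s = gtp t ↔ Relation.TransGen Eat s t := by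
  have : Std.Symm (Eat (K := K1.{u} p₁ p₂) (A := A)) := ⟨fun _ _ => Eat.symm⟩
  constructor
  · intro h
    exact h.ge (.single (K1_Eat_refl hp₁ hp₂ t))
  · intro h
    ext r
    exact ⟨fun h' => (Std.Symm.symm _ _ h).trans h', fun h' => h.trans h'⟩

theorem K1_gtp_eq_of_Eat (hp₁ : p₁.Prime) (hp₂ : p₂.Prime) {s t : (K1.{u} p₁ p₂).Triple A}
    (h : Eat s t) : gtp s = gtp t :=
  (K1_gtp_eq_iff hp₁ hp₂).mpr (.single h)

/-- A property of triples preserved by the atomic relation is preserved by equality of types. -/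
theorem K1_gtp_eq_imp (hp₁ : p₁.Prime) (hp₂ : p₂.Prime) (P : (K1.{u} p₁ p₂).Triple A → Prop)
    (hP : ∀ s t, Eat s t → P s → P t) {s t : (K1.{u} p₁ p₂).Triple A} (h : gtp s = gtp t)
    (hs : P s) : P t := by
  rw [K1_gtp_eq_iff hp₁ hp₂] at h
  induction h with
  | single h => exact hP _ _ h hs
  | tail _ h ih => exact hP _ _ h ih

theorem K1_gtp_eq_zsmul (hp₁ : p₁.Prime) (hp₂ : p₂.Prime) {s t : (K1.{u} p₁ p₂).Triple A}
    (h : gtp s = gtp t) (n k : ℤ) (a : A) (hs : ∃ y, n • y = k • s.b + s.incl a) :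
    ∃ y, n • y = k • t.b + t.incl a := by
  refine K1_gtp_eq_imp hp₁ hp₂ (fun s => ∃ y, n • y = k • s.b + s.incl a) ?_ h hs
  rintro s t ⟨N, _, f, g, hN, hf, hg, hA, hb⟩ hs
  rw [← K1_isEmb_zsmul_iff hp₁ hp₂ hf] at hs
  rw [← K1_isEmb_zsmul_iff hp₁ hp₂ hg]
  simpa only [map_add, map_zsmul, hA, hb] using hs

theorem K1_gtp_eq_restrict_univ (hp₁ : p₁.Prime) (hp₂ : p₂.Prime) {s t : (K1.{u} p₁ p₂).Triple A}
    (h : gtp (s.restrict Set.univ) = gtp (t.restrict Set.univ)) : gtp s = gtp t := by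
  rw [K1_gtp_eq_iff hp₁ hp₂] at h ⊢
  let F (r : (K1.{u} p₁ p₂).Triple (Set.univ : Set A)) : (K1.{u} p₁ p₂).Triple A :=
    { N := r.N, mem := r.mem, incl := (Equiv.Set.univ A).symm.toEmbedding.trans r.incl, b := r.b }
  refine Relation.TransGen.lift F ?_ _ _ h
  rintro r r' ⟨N, _, f, g, hN, hf, hg, hA, hb⟩
  exact ⟨N, _, f, g, hN, hf, hg, fun a => hA _, hb⟩

/-- The subgroup of `N₁ × N₂` of the pairs that have a common nonzero multiple of the form
`(g₁ x, g₂ x)`. -/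
def commonDivClosure {F N₁ N₂ : Type u} [AddCommGroup F] [AddCommGroup N₁] [AddCommGroup N₂]
    (g₁ : F →+ N₁) (g₂ : F →+ N₂) : AddSubgroup (N₁ × N₂) :=
  (g₁.prod g₂).range.divClosure

section commonDivClosure

variable {F N₁ N₂ : Type u} [AddCommGroup F] [AddCommGroup N₁] [AddCommGroup N₂]
    {g₁ : F →+ N₁} {g₂ : F →+ N₂}

theorem mem_commonDivClosure {y : N₁ × N₂} : y ∈ commonDivClosure g₁ g₂ ↔
    ∃ n : ℤ, n ≠ 0 ∧ ∃ x, g₁ x = n • y.1 ∧ g₂ x = n • y.2 := by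
  refine exists_congr fun n => and_congr_right fun _ => exists_congr fun x => ?_
  rw [Prod.ext_iff]
  rfl

/-- When `g₁ x` and `g₂ x` satisfy the same divisibilities, `commonDivClosure` is the graph of an
isomorphism between the division closures of the two ranges. It serves as a common strong submodel
of `N₁` and `N₂`. -/
theorem commonDivClosure_fst_injective [IsAddTorsionFree N₁] [IsAddTorsionFree N₂]
    (h : ∀ x, g₁ x = 0 → g₂ x = 0) :
    Function.Injective ((AddMonoidHom.fst N₁ N₂).comp (commonDivClosure g₁ g₂).subtype) := by
  rw [injective_iff_map_eq_zero]
  rintro ⟨⟨y, z⟩, hyz⟩ (rfl : y = 0)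
  obtain ⟨n, hn, x, h₁, h₂⟩ := mem_commonDivClosure.mp hyz
  have : n • z = n • 0 := by
    rw [← h₂, h x (by simpa using h₁), smul_zero]
  exact Subtype.ext (Prod.ext rfl (zsmul_right_injective hn this))

theorem commonDivClosure_fst_range
    (h : ∀ x (n : ℤ), (∃ y, n • y = g₁ x) → ∃ y, n • y = g₂ x) :
    ((AddMonoidHom.fst N₁ N₂).comp (commonDivClosure g₁ g₂).subtype).range =
      g₁.range.divClosure := by
  ext y
  constructor
  · rintro ⟨⟨⟨y, z⟩, hyz⟩, rfl⟩
    obtain ⟨n, hn, x, h₁, -⟩ := mem_commonDivClosure.mp hyz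
    exact ⟨n, hn, x, h₁⟩
  · rintro ⟨n, hn, x, hx⟩
    obtain ⟨z, hz⟩ := h x n ⟨y, hx.symm⟩
    exact ⟨⟨(y, z), mem_commonDivClosure.mpr ⟨n, hn, x, hx, hz.symm⟩⟩, rfl⟩

theorem commonDivClosure_fst_isEmb (hp₁ : p₁.Prime) (hp₂ : p₂.Prime) (hN₁ : K1Mem p₁ p₂ N₁)
    (hN₂ : K1Mem p₁ p₂ N₂) (hD₁ : pOmega p₁ N₁ ≤ g₁.range) (hD₂ : pOmega p₂ N₁ ≤ g₁.range)
    (h : ∀ x (n : ℤ), (∃ y, n • y = g₁ x) → ∃ y, n • y = g₂ x) :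
    (K1 p₁ p₂).IsEmb ((AddMonoidHom.fst N₁ N₂).comp (commonDivClosure g₁ g₂).subtype) := by
  have := hN₁.1
  have := hN₂.1
  rw [K1_isEmb_iff hp₁ hp₂, commonDivClosure_fst_range h]
  refine ⟨commonDivClosure_fst_injective fun x hx => ?_, hN₁,
    AddSubgroup.isDivClosed_divClosure _, hD₁.trans (AddSubgroup.le_divClosure _),
    Or.inr (hD₂.trans (AddSubgroup.le_divClosure _))⟩
  -- Divisibility by `0` expresses vanishing, so `h` also controls kernels.
  obtain ⟨y, hy⟩ := h x 0 ⟨0, by simp [hx]⟩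
  simpa using hy.symm

theorem commonDivClosure_snd_isEmb (hp₁ : p₁.Prime) (hp₂ : p₂.Prime) (hN₁ : K1Mem p₁ p₂ N₁)
    (hN₂ : K1Mem p₁ p₂ N₂) (hD₁ : pOmega p₁ N₂ ≤ g₂.range) (hD₂ : pOmega p₂ N₂ ≤ g₂.range)
    (h : ∀ x (n : ℤ), (∃ y, n • y = g₂ x) → ∃ y, n • y = g₁ x) :
    (K1 p₁ p₂).IsEmb ((AddMonoidHom.snd N₁ N₂).comp (commonDivClosure g₁ g₂).subtype) := by
  have key := commonDivClosure_fst_isEmb hp₁ hp₂ hN₂ hN₁ hD₁ hD₂ h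
  have hswap (y : N₁ × N₂) (hy : y ∈ commonDivClosure g₁ g₂) :
      y.swap ∈ commonDivClosure g₂ g₁ := by
    rw [mem_commonDivClosure] at hy ⊢
    obtain ⟨n, hn, x, h₁, h₂⟩ := hy
    exact ⟨n, hn, x, h₂, h₁⟩
  have hswap' (y : N₂ × N₁) (hy : y ∈ commonDivClosure g₂ g₁) :
      y.swap ∈ commonDivClosure g₁ g₂ := by
    rw [mem_commonDivClosure] at hy ⊢
    obtain ⟨n, hn, x, h₁, h₂⟩ := hy
    exact ⟨n, hn, x, h₂, h₁⟩
  refine ⟨fun y z hyz => ?_, ?_⟩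
  · have := @key.1 ⟨_, hswap y y.2⟩ ⟨_, hswap z z.2⟩ hyz
    exact Subtype.ext (Prod.swap_injective (congrArg Subtype.val this))
  · convert key.2 using 1
    ext y
    constructor
    · rintro ⟨z, rfl⟩
      exact ⟨⟨_, hswap z z.2⟩, rfl⟩
    · rintro ⟨z, rfl⟩
      exact ⟨⟨_, hswap' z z.2⟩, rfl⟩

end commonDivClosure

variable {M : Type u} [AddCommGroup M]

/-- Over a model that is not `p₁`-divisible, a Galois type is determined by the divisibility
relations it contains. -/
theorem K1_gtp_eq_of_zsmul_iff (hp₁ : p₁.Prime) (hp₂ : p₂.Prime) {m₀ : M} (hm₀ : m₀ ∉ pOmega p₁ M)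
    {s t : (K1.{u} p₁ p₂).Triple M} (hs : s.IsStrong) (ht : t.IsStrong)
    (h : ∀ (n k : ℤ) (m : M),
      (∃ y, n • y = k • s.b + s.incl m) ↔ ∃ y, n • y = k • t.b + t.incl m) :
    gtp s = gtp t := by
  obtain ⟨f, hfs, hf⟩ := hs
  obtain ⟨g, hgt, hg⟩ := ht
  simp only [← hfs, ← hgt] at h
  -- The map `(m, k) ↦ k b + m`; its range contains both divisible parts because `M`, not being
  -- `p₁`-divisible, already does.
  let G (r : (K1.{u} p₁ p₂).Triple M) (f : M →+ r.N) : M × ULift.{u} ℤ →+ r.N :=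
    f.coprod ((zmultiplesHom r.N r.b).comp AddEquiv.ulift.toAddMonoidHom)
  have hG (r) (f : M →+ r.N) (m k) : G r f (m, k) = k.down • r.b + f m := by
    rw [add_comm]
    rfl
  have hle (r) (f : M →+ r.N) : f.range ≤ (G r f).range := by
    rintro _ ⟨m, rfl⟩
    exact ⟨(m, 0), by simp [hG]⟩
  have hD (r) (f : M →+ r.N) (hf : (K1 p₁ p₂).IsEmb f) : pOmega p₁ r.N ≤ (G r f).range :=
    ((K1_isEmb_iff hp₁ hp₂ f).mp hf).2.2.2.1.trans (hle r f)
  have hE (r) (f : M →+ r.N) (hf : (K1 p₁ p₂).IsEmb f) : pOmega p₂ r.N ≤ (G r f).range :=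
    (K1_isEmb_pOmega_le hp₁ hp₂ hf hm₀).trans (hle r f)
  have h' (x : M × ULift.{u} ℤ) (n : ℤ) : (∃ y, n • y = G s f x) ↔ ∃ y, n • y = G t g x := by
    obtain ⟨m, k⟩ := x
    simp only [hG]
    exact h _ _ _
  have e₁ := commonDivClosure_fst_isEmb hp₁ hp₂ s.mem t.mem (hD s f hf) (hE s f hf)
    fun x n => (h' x n).mp
  have e₂ := commonDivClosure_snd_isEmb hp₁ hp₂ s.mem t.mem (hD t g hg) (hE t g hg)
    fun x n => (h' x n).mpr
  have hmem (x) : (G s f x, G t g x) ∈ commonDivClosure (G s f) (G t g) :=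
    AddSubgroup.le_divClosure _ ⟨x, rfl⟩
  -- The common submodel gives a triple embedding into both `s` and `t`, so two atomic steps connect
  -- them and no amalgam is needed.
  let r : (K1.{u} p₁ p₂).Triple M :=
    { N := commonDivClosure (G s f) (G t g)
      mem := s.mem.of_injective _ e₁.1
      incl := ⟨fun m => ⟨_, hmem (m, 0)⟩, fun m m' hmm => hf.1 (by
        simpa [hG] using congrArg (fun y => y.1.1) hmm)⟩
      b := ⟨_, hmem (0, 1)⟩ }
  have hr₁ : Eat r s := ⟨s.N, _, _, .id _, s.mem, e₁, K1_isEmb_id hp₁ hp₂ s.mem,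
    fun m => by
      show G s f (m, 0) = s.incl m
      simp [hG, hfs], by
      show G s f (0, 1) = s.b
      simp [hG]⟩
  have hr₂ : Eat r t := ⟨t.N, _, _, .id _, t.mem, e₂, K1_isEmb_id hp₁ hp₂ t.mem,
    fun m => by
      show G t g (m, 0) = t.incl m
      simp [hG, hgt], by
      show G t g (0, 1) = t.b
      simp [hG]⟩
  exact (K1_gtp_eq_of_Eat hp₁ hp₂ hr₁).symm.trans (K1_gtp_eq_of_Eat hp₁ hp₂ hr₂)

end Types

/-! ### Tameness for countable parameter sets -/

section Tameness

open GroupClass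

variable {p₁ p₂ : ℕ}

theorem exists_not_mem_pOmega {M : Type u} [AddCommGroup M] {p : ℕ}
    (hM : #(pOmega p M) < #M) : ∃ m, m ∉ pOmega p M := by
  by_contra! h
  rw [(eq_top_iff.mpr fun m _ => h m : pOmega p M = ⊤)] at hM
  exact hM.ne (Cardinal.mk_congr (AddSubgroup.topEquiv (G := M)).toEquiv)

theorem K1_tame_aleph0 (hp₁ : p₁.Prime) (hp₂ : p₂.Prime) : (K1.{u} p₁ p₂).Tame ℵ₀ := by
  intro θ _ M _ hM _ s t hs ht hst
  simp only [Order.lt_succ_iff]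
  by_contra! hcon
  -- A countable `M` is itself an admissible parameter set; an uncountable one is not
  -- `p₁`-divisible, and then single parameters suffice.
  by_cases hcount : #M ≤ ℵ₀
  · exact hst (K1_gtp_eq_restrict_univ hp₁ hp₂ (hcon Set.univ (by simpa using hcount)))
  obtain ⟨m₀, hm₀⟩ := exists_not_mem_pOmega (hM.2.1.trans_lt (not_le.mp hcount))
  apply hst
  refine K1_gtp_eq_of_zsmul_iff hp₁ hp₂ hm₀ hs ht fun n k m => ?_
  have h := hcon {m} (by simp)
  exact ⟨K1_gtp_eq_zsmul hp₁ hp₂ h n k ⟨m, rfl⟩, K1_gtp_eq_zsmul hp₁ hp₂ h.symm n k ⟨m, rfl⟩⟩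

end Tameness

/-! ### The stability spectrum -/

section Stability

open GroupClass

variable {p₁ p₂ : ℕ}

theorem K1_stableIn_of_power_eq (hp₁ : p₁.Prime) (hp₂ : p₂.Prime) {μ : Cardinal.{u}} (hμ : ℵ₀ ≤ μ)
    (hpow : μ ^ (ℵ₀ : Cardinal.{u}) = μ) : (K1.{u} p₁ p₂).StableIn μ := by
  intro M _ hM hcard
  have hlt : #(pOmega p₁ M) < #M := by
    refine hM.2.1.trans_lt (hcard ▸ ?_)
    rw [← hpow]
    exact (Cardinal.cantor _).trans_le (Cardinal.power_le_power_right (ofNat_lt_aleph0.le.trans hμ))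
  obtain ⟨m₀, hm₀⟩ := exists_not_mem_pOmega hlt
  classical
  -- For each `(n, k)` record one `m` with `n ∣ k b + m`, if any. The other solutions differ from it
  -- by elements of `M` divisible by `n`, and purity makes this a property of `M` alone.
  let F (s : (K1.{u} p₁ p₂).Triple M) (nk : ℤ × ℤ) : Option M :=
    if h : ∃ m, ∃ y, nk.1 • y = nk.2 • s.b + s.incl m then some h.choose else none
  have hF {s t : (K1.{u} p₁ p₂).Triple M} (hs : s.IsStrong) (ht : t.IsStrong) (h : F s = F t)
      (n k : ℤ) (m : M) (hm : ∃ y, n • y = k • s.b + s.incl m) :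
      ∃ y, n • y = k • t.b + t.incl m := by
    have hex : ∃ m, ∃ y, n • y = k • s.b + s.incl m := ⟨m, hm⟩
    have h' := congrFun h (n, k)
    simp only [F, dif_pos hex] at h'
    split_ifs at h' with hex'
    have hc := hex'.choose_spec
    rw [← Option.some_injective _ h'] at hc
    obtain ⟨f, hfs, hf⟩ := hs
    obtain ⟨g, hgt, hg⟩ := ht
    obtain ⟨y, hy⟩ := hm
    obtain ⟨y', hy'⟩ := hex.choose_spec
    obtain ⟨z, hz⟩ := hc
    rw [← hfs] at hy hy'
    rw [← hgt] at hz ⊢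
    obtain ⟨w, hw⟩ := (K1_isEmb_zsmul_iff hp₁ hp₂ hf (n := n) (x := m - hex.choose)).mp
      ⟨y - y', by rw [smul_sub, hy, hy', map_sub]; abel⟩
    refine ⟨z + g w, ?_⟩
    rw [smul_add, hz, ← map_zsmul, hw, map_sub]
    abel
  choose s hs using fun p : (K1.{u} p₁ p₂).gS M => p.2
  have hinj : Function.Injective fun p => F (s p) := fun p q hpq => by
    refine Subtype.ext ((hs p).2.symm.trans (Eq.trans ?_ (hs q).2))
    exact K1_gtp_eq_of_zsmul_iff hp₁ hp₂ hm₀ (hs p).1 (hs q).1 fun n k m =>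
      ⟨hF (hs p).1 (hs q).1 hpq n k m, hF (hs q).1 (hs p).1 hpq.symm n k m⟩
  have h := Cardinal.lift_mk_le_lift_mk_of_injective hinj
  rw [Cardinal.lift_umax.{u, u + 1}, Cardinal.lift_id'.{u, u + 1}] at h
  refine h.trans (Cardinal.lift_le.mpr (le_of_eq ?_))
  have hopt : #(Option M) = μ := by
    rw [Cardinal.mk_option, hcard, Cardinal.add_one_eq hμ]
  rw [← Cardinal.lift_inj.{u, 0}]
  simp [hopt, hpow]

/-- Elements of a group of functions with values in `ℤ` are not infinitely divisible. -/
theorem pOmega_pi_int {p : ℕ} (hp : p.Prime) (I : Type u) : pOmega p (I → ℤ) = ⊥ := by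
  rw [eq_bot_iff]
  intro x hx
  rw [AddSubgroup.mem_bot]
  funext i
  by_contra hi
  -- The exponent `|x i|` suffices, since `p ^ k > k`.
  obtain ⟨y, hy⟩ := hx (x i).natAbs
  have h1 : ((p ^ (x i).natAbs : ℕ) : ℤ) ∣ x i := ⟨y i, by simpa using (congrFun hy i).symm⟩
  have h2 := Nat.le_of_dvd (Int.natAbs_pos.mpr hi) (Int.natCast_dvd.mp h1)
  exact absurd (Nat.lt_pow_self hp.one_lt) (not_lt.mpr h2)

theorem K1Mem_pi_int (hp₁ : p₁.Prime) (hp₂ : p₂.Prime) (I : Type u) : K1Mem p₁ p₂ (I → ℤ) := by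
  refine ⟨inferInstance, ?_, ?_⟩
  · rw [pOmega_pi_int hp₁]
    simp
  · rw [pOmega_pi_int hp₂]
    simp

theorem K1_finsupp_isEmb (hp₁ : p₁.Prime) (hp₂ : p₂.Prime) (I : Type u) :
    (K1.{u} p₁ p₂).IsEmb (Finsupp.coeFnAddHom : (I →₀ ℤ) →+ (I → ℤ)) := by
  refine K1_isEmb_of_pOmega_eq_bot hp₁ hp₂ (K1Mem_pi_int hp₁ hp₂ I) DFunLike.coe_injective ?_
    (pOmega_pi_int hp₁ I) (pOmega_pi_int hp₂ I)
  rintro n g hn ⟨l, hl⟩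
  refine ⟨Finsupp.ofSupportFinite g (l.hasFiniteSupport.subset fun i hi => ?_), rfl⟩
  have : l i = n * g i := by simpa using congrFun hl i
  rw [Function.mem_support, this]
  exact mul_ne_zero hn hi

/-- Each `η : ℕ → X` gives the infinite sum of `2 ^ l` times the basis vector at `(l, η l)`. Its
partial sums lie in the free group and approximate it 2-adically, so its type recovers `η`. -/
theorem power_eq_of_K1_stableIn (hp₁ : p₁.Prime) (hp₂ : p₂.Prime) {μ : Cardinal.{u}} (hμ : ℵ₀ ≤ μ)
    (hst : (K1.{u} p₁ p₂).StableIn μ) : μ ^ (ℵ₀ : Cardinal.{u}) = μ := by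
  refine le_antisymm ?_ (Cardinal.self_le_power μ (by exact_mod_cast one_le_aleph0))
  induction μ using Cardinal.inductionOn with | _ X
  have : Infinite X := Cardinal.aleph0_le_mk_iff.mp hμ
  let I := ℕ × X
  have hI : #I = #X := by
    simp only [I, Cardinal.mk_prod]
    simp
  have hcard : #(I →₀ ℤ) = #X := by
    have : #(I →₀ ℤ) = #I := by
      simp [Cardinal.mk_finsupp_lift_of_infinite]
    rw [this, hI]
  have hM : K1Mem p₁ p₂ (I →₀ ℤ) :=
    (K1Mem_pi_int hp₁ hp₂ I).of_injective Finsupp.coeFnAddHom DFunLike.coe_injective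
  classical
  let b (η : ℕ → X) : I → ℤ := fun i => if η i.1 = i.2 then 2 ^ i.1 else 0
  let s (η : ℕ → X) : (K1.{u} p₁ p₂).Triple (I →₀ ℤ) :=
    { N := I → ℤ
      mem := K1Mem_pi_int hp₁ hp₂ I
      incl := ⟨(⇑), DFunLike.coe_injective⟩
      b := b η }
  have hs (η) : (s η).IsStrong :=
    ⟨Finsupp.coeFnAddHom, fun _ => rfl, K1_finsupp_isEmb hp₁ hp₂ I⟩
  have hinj : Function.Injective fun η => (⟨gtp (s η), s η, hs η, rfl⟩ : (K1.{u} p₁ p₂).gS _) := by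
    intro η η' h
    have h : gtp (s η) = gtp (s η') := congrArg Subtype.val h
    funext j
    by_contra hj
    -- Subtracting the terms up to and including `j` leaves a multiple of `2 ^ (j + 1)`. For `η'`
    -- with `η' j ≠ η j`, the coordinate at `(j, η j)` is `-2 ^ j`, which is not one.
    have h2 := K1_gtp_eq_zsmul hp₁ hp₂ h (2 ^ (j + 1)) 1
      (-∑ l ∈ Finset.range (j + 1), Finsupp.single (l, η l) (2 ^ l)) ?_
    · obtain ⟨y, hy⟩ := h2
      have hy := congrFun hy (j, η j)
      have e : (∑ l ∈ Finset.range (j + 1), Finsupp.single (l, η l) ((2 : ℤ) ^ l)) (j, η j)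
          = 2 ^ j := by
        rw [Finsupp.finsetSum_apply, Finset.sum_eq_single j] <;>
          simp +contextual
      have hy : 2 ^ (j + 1) * y (j, η j) = b η' (j, η j) + -(2 ^ j : ℤ) := by
        rw [← e]
        simpa [s] using hy
      have hb : b η' (j, η j) = 0 := if_neg fun h => hj h.symm
      have h3 : (2 : ℤ) ^ j * (2 * y (j, η j) + 1) = 0 := by
        rw [hb] at hy
        linear_combination hy
      have := (mul_eq_zero.mp h3).resolve_left (by positivity)
      omega
    · refine ⟨fun i => if η i.1 = i.2 ∧ j < i.1 then 2 ^ (i.1 - (j + 1)) else 0, ?_⟩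
      funext ⟨l, x⟩
      have e : (∑ l ∈ Finset.range (j + 1), Finsupp.single (l, η l) ((2 : ℤ) ^ l)) (l, x)
          = if η l = x ∧ ¬ j < l then 2 ^ l else 0 := by
        rw [Finsupp.finsetSum_apply]
        by_cases hl : l ∈ Finset.range (j + 1)
        · rw [Finset.sum_eq_single_of_mem l hl]
          · have : ¬ j < l := by simpa [Nat.lt_succ_iff] using hl
            simp [Finsupp.single_apply, this]
          · intro l' _ hl'
            simp [hl']
        · rw [Finset.sum_eq_zero, if_neg]
          · simp at hl ⊢
            intros; omega
          · intro l' hl'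
            have : l' ≠ l := fun h => hl (h ▸ hl')
            simp [this]
      show (2 : ℤ) ^ (j + 1) • (if η l = x ∧ j < l then (2 : ℤ) ^ (l - (j + 1)) else 0) =
        (1 : ℤ) • b η (l, x) + (-∑ l ∈ Finset.range (j + 1),
          Finsupp.single (l, η l) ((2 : ℤ) ^ l)) (l, x)
      rw [Finsupp.neg_apply, e]
      by_cases hx : η l = x <;> by_cases hl : j < l <;> simp [b, hx, hl]
      rw [← pow_add]
      congr 1
      omega
  have h := Cardinal.lift_mk_le_lift_mk_of_injective hinj
  rw [Cardinal.lift_umax.{u, u + 1}, Cardinal.lift_id'.{u, u + 1}] at h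
  have h' := Cardinal.lift_le.mp (h.trans (hst _ hM hcard))
  simpa using h'

end Stability

/-! ### Localizations of the integers at a prime -/

section RatLocalization

variable (p : ℕ) [hp : Fact p.Prime]

/-- The localization of `ℤ` at the prime `p`, as a subring of `ℚ`. -/
def ratLocalization : Subring ℚ where
  carrier := {x | padicNorm p x ≤ 1}
  mul_mem' {x y} hx hy := by
    rw [Set.mem_ofPred_eq, padicNorm.mul]
    exact mul_le_one₀ hx (padicNorm.nonneg _) hy
  one_mem' := by simp
  add_mem' {x y} hx hy := padicNorm.nonarchimedean.trans (max_le hx hy)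
  zero_mem' := by simp
  neg_mem' {x} hx := by simpa using hx

variable {p}

theorem mem_ratLocalization {x : ℚ} : x ∈ ratLocalization p ↔ padicNorm p x ≤ 1 := Iff.rfl

theorem inv_mem_ratLocalization {n : ℕ} (hn : ¬ p ∣ n) : (n : ℚ)⁻¹ ∈ ratLocalization p := by
  rw [mem_ratLocalization, ← one_div, padicNorm.div, padicNorm.one,
    (padicNorm.nat_eq_one_iff n).mpr hn, div_one]

theorem inv_prime_mem_ratLocalization {r : ℕ} (hr : r.Prime) (h : r ≠ p) :
    (r : ℚ)⁻¹ ∈ ratLocalization p :=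
  inv_mem_ratLocalization fun hd => h ((Nat.prime_dvd_prime_iff_eq hp.out hr).mp hd).symm

theorem inv_self_notMem_ratLocalization : (p : ℚ)⁻¹ ∉ ratLocalization p := by
  rw [mem_ratLocalization, ← one_div, padicNorm.div, padicNorm.one,
    padicNorm.padicNorm_p_of_prime, not_le, one_div, inv_inv]
  exact_mod_cast hp.out.one_lt

theorem eq_zero_of_ratLocalization {x : ℚ}
    (h : ∀ n : ℕ, ∃ y ∈ ratLocalization p, (p : ℚ) ^ n * y = x) : x = 0 := by
  by_contra hx
  have hpos : 0 < padicNorm p x := (padicNorm.nonneg x).lt_of_ne (padicNorm.nonzero hx).symm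
  have h1 : ((p : ℚ)⁻¹) < 1 := inv_lt_one_of_one_lt₀ (by exact_mod_cast hp.out.one_lt)
  obtain ⟨n, hn⟩ := exists_pow_lt_of_lt_one hpos h1
  obtain ⟨y, hy, rfl⟩ := h n
  rw [padicNorm.mul] at hn
  have e : ∀ n : ℕ, padicNorm p ((p : ℚ) ^ n) = (p : ℚ)⁻¹ ^ n := by
    intro n
    induction n with
    | zero => simp
    | succ n ih => rw [pow_succ, padicNorm.mul, ih, padicNorm.padicNorm_p_of_prime, pow_succ]
  rw [e] at hn
  exact absurd hn (not_lt.mpr (mul_le_of_le_one_right (by positivity) hy))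

theorem pOmega_ratLocalization : pOmega p (ratLocalization p) = ⊥ := by
  rw [eq_bot_iff]
  intro x hx
  refine Subtype.ext (eq_zero_of_ratLocalization (p := p) fun n => ?_)
  obtain ⟨y, hy⟩ := hx n
  exact ⟨y, y.2, by simpa using congrArg Subtype.val hy⟩

end RatLocalization

/-! ### Maximal models, joint embedding and amalgamation -/

section Examples

variable {p₁ p₂ : ℕ}

theorem pOmega_ulift {p : ℕ} {G : Type} [AddCommGroup G] {x : ULift.{u} G} :
    x ∈ pOmega p (ULift.{u} G) ↔ x.down ∈ pOmega p G := by
  refine forall_congr' fun n => ⟨?_, ?_⟩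
  · rintro ⟨h, rfl⟩
    exact ⟨h.down, rfl⟩
  · rintro ⟨h, hh⟩
    exact ⟨⟨h⟩, ULift.ext _ _ hh⟩

theorem K1Mem_of_countable {G : Type u} [AddCommGroup G] [Countable G] [IsAddTorsionFree G] :
    K1Mem p₁ p₂ G :=
  ⟨inferInstance, Cardinal.mk_le_aleph0, Cardinal.mk_le_aleph0⟩

instance {G : Type*} [AddCommGroup G] [IsAddTorsionFree G] : IsAddTorsionFree (ULift.{u} G) :=
  Function.Injective.isAddTorsionFree (AddEquiv.ulift (α := G)).toAddMonoidHom
    (AddEquiv.ulift (α := G)).injective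

theorem K1_noMaximalModels (hp₁ : p₁.Prime) (hp₂ : p₂.Prime) :
    (K1.{u} p₁ p₂).NoMaximalModels := by
  intro M _ hM
  have := hM.1
  have hD {p : ℕ} (hp : p.Prime) (x : M × (PUnit.{u + 1} → ℤ)) (hx : x ∈ pOmega p _) : x.2 = 0 := by
    have := map_mem_pOmega (AddMonoidHom.snd _ _) hx
    rwa [pOmega_pi_int hp] at this
  have hcount {p : ℕ} (hp : p.Prime) (h : #(pOmega p M) ≤ ℵ₀) :
      #(pOmega p (M × (PUnit.{u + 1} → ℤ))) ≤ ℵ₀ := by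
    refine (Cardinal.mk_le_of_injective (f := fun x : pOmega p _ =>
      (⟨x.1.1, map_mem_pOmega (AddMonoidHom.fst _ _) x.2⟩ : pOmega p M)) ?_).trans h
    intro x y hxy
    refine Subtype.ext (Prod.ext (congrArg Subtype.val hxy) ?_)
    rw [hD hp _ x.2, hD hp _ y.2]
  have hle {p : ℕ} (hp : p.Prime) :
      pOmega p (M × (PUnit.{u + 1} → ℤ)) ≤ (AddMonoidHom.inl M (PUnit.{u + 1} → ℤ)).range :=
    fun x hx => ⟨x.1, Prod.ext rfl (hD hp x hx).symm⟩
  refine ⟨M × (PUnit.{u + 1} → ℤ), inferInstance, AddMonoidHom.inl _ _,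
    ⟨inferInstance, hcount hp₁ hM.2.1, hcount hp₂ hM.2.2⟩, ?_, fun h => ?_⟩
  · refine (K1_isEmb_iff hp₁ hp₂ _).mpr ⟨fun x y h => congrArg Prod.fst h,
      ⟨inferInstance, hcount hp₁ hM.2.1, hcount hp₂ hM.2.2⟩, ?_, hle hp₁, Or.inr (hle hp₂)⟩
    rintro n g hn ⟨x, hx⟩
    have h2 : n • g.2 = n • 0 := by
      rw [smul_zero]
      exact (congrArg Prod.snd hx).symm
    exact ⟨g.1, Prod.ext rfl (zsmul_right_injective hn h2).symm⟩
  · obtain ⟨x, hx⟩ := h (0, 1)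
    exact zero_ne_one (congrFun (congrArg Prod.snd hx) PUnit.unit)

/-- The `p₁`-part is the same in all extensions, but it is `0` in the zero group and everything in
`ℚ`. -/
theorem K1_not_jointEmbedding (hp₁ : p₁.Prime) (hp₂ : p₂.Prime) :
    ¬ (K1.{u} p₁ p₂).JointEmbedding := by
  intro h
  obtain ⟨N, _, f, g, hN, hf, hg⟩ := h PUnit (ULift.{u} ℚ) K1Mem_of_countable K1Mem_of_countable
  have h1 : (1 : ULift.{u} ℚ) ∈ pOmega p₁ (ULift.{u} ℚ) := by
    rw [pOmega_ulift]
    intro n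
    exact ⟨((p₁ : ℚ) ^ n)⁻¹, by simp [hp₁.ne_zero]⟩
  obtain ⟨x, hx⟩ := ((K1_isEmb_iff hp₁ hp₂ f).mp hf).2.2.2.1
    ((K1_isEmb_mem_pOmega_iff hp₁ hp₂ hg).mpr h1)
  have : g 1 = g 0 := by rw [← hx, Subsingleton.elim x 0, map_zero, map_zero]
  exact one_ne_zero (congrArg ULift.down (hg.1 this))

/-- Over `0`, take `ℤ` and `ℤ_(p₁)`. As `ℤ` is not `p₁`-divisible, it freezes the `p₂`-part of an
amalgam at `0`, while `1 ∈ ℤ_(p₁)` is `p₂`-divisible. -/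
theorem K1_not_amalgamation (hp₁ : p₁.Prime) (hp₂ : p₂.Prime) (hne : p₁ ≠ p₂) :
    ¬ (K1.{u} p₁ p₂).Amalgamation := by
  have := Fact.mk hp₁
  intro h
  have hemb {G : Type u} [AddCommGroup G] (hG : K1Mem p₁ p₂ G) (h₁ : pOmega p₁ G = ⊥) :
      (K1 p₁ p₂).IsEmb (0 : PUnit.{u + 1} →+ G) := by
    have := hG.1
    have hr : (0 : PUnit.{u + 1} →+ G).range = ⊥ := AddMonoidHom.range_zero
    rw [K1_isEmb_iff hp₁ hp₂, hr, h₁]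
    refine ⟨fun _ _ _ => rfl, hG, fun n g hn hg => ?_, le_rfl, Or.inl le_rfl⟩
    rw [← h₁] at hg ⊢
    exact isDivClosed_pOmega hp₁ n g hn hg
  let L := ULift.{u} (ratLocalization p₁)
  have hL : pOmega p₁ L = ⊥ := by
    rw [eq_bot_iff]
    intro x hx
    rw [pOmega_ulift, pOmega_ratLocalization] at hx
    exact ULift.ext _ _ hx
  have hL₂ : (1 : L) ∈ pOmega p₂ L := by
    rw [pOmega_ulift]
    intro n
    refine ⟨⟨((p₂ : ℚ)⁻¹) ^ n, pow_mem (inv_prime_mem_ratLocalization hp₂ hne.symm) n⟩, ?_⟩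
    refine Subtype.ext ?_
    simp [hp₂.ne_zero]
  have hZ {p : ℕ} (hp : p.Prime) := pOmega_pi_int hp PUnit.{u + 1}
  obtain ⟨N, _, f, g, hN, hf, hg, hfg⟩ := h PUnit (PUnit.{u + 1} → ℤ) L 0 0 K1Mem_of_countable
    K1Mem_of_countable K1Mem_of_countable (hemb K1Mem_of_countable (hZ hp₁))
    (hemb K1Mem_of_countable hL)
  have h1 : (1 : PUnit.{u + 1} → ℤ) ∉ pOmega p₁ (PUnit.{u + 1} → ℤ) := by
    rw [hZ hp₁, AddSubgroup.mem_bot]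
    exact one_ne_zero
  have hg1 := (K1_isEmb_mem_pOmega_iff hp₁ hp₂ hg).mpr hL₂
  obtain ⟨x, hx⟩ := K1_isEmb_pOmega_le hp₁ hp₂ hf h1 hg1
  rw [← hx, K1_isEmb_mem_pOmega_iff hp₁ hp₂ hf, hZ hp₂, AddSubgroup.mem_bot] at hg1
  rw [hg1, map_zero, ← map_zero g] at hx
  exact zero_ne_one (congrArg ULift.down (hg.1 hx))

end Examples

/-! ### Failure of tameness for finite parameter sets -/

section NonTameness

open GroupClass

/-- The sum of the coordinates. -/
noncomputable def coordSum : (ℕ →₀ ℚ) →+ ℚ := Finsupp.liftAddHom fun _ => AddMonoidHom.id ℚ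

theorem coordSum_single (i : ℕ) (a : ℚ) : coordSum (Finsupp.single i a) = a := by
  simp [coordSum]

theorem coordSum_smul (a : ℚ) (x : ℕ →₀ ℚ) : coordSum (a • x) = a * coordSum x := by
  simp [coordSum, Finsupp.sum_smul_index', Finsupp.mul_sum]

theorem coordSum_mem (S : AddSubgroup ℚ) {x : ℕ →₀ ℚ} (h : ∀ i, x i ∈ S) : coordSum x ∈ S := by
  simp only [coordSum, Finsupp.liftAddHom_apply]
  exact AddSubgroup.sum_mem _ fun i _ => h i

variable (p₁ p₂ q : ℕ) [hp₁ : Fact p₁.Prime] [hp₂ : Fact p₂.Prime] [hq : Fact q.Prime]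

/-- The sequences of elements of `ℤ_(p₂)` whose `i`-th term has a denominator dividing `q ^ i` up
to units of `ℤ_(q)`. -/
def boundedSeq : AddSubgroup (ℕ →₀ ℚ) where
  carrier := {x | ∀ i, x i ∈ ratLocalization p₂ ∧ (q : ℚ) ^ i * x i ∈ ratLocalization q}
  zero_mem' i := by simp
  add_mem' {x y} hx hy i := by
    refine ⟨add_mem (hx i).1 (hy i).1, ?_⟩
    rw [Finsupp.add_apply, mul_add]
    exact add_mem (hx i).2 (hy i).2
  neg_mem' {x} hx i := by
    refine ⟨neg_mem (hx i).1, ?_⟩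
    rw [Finsupp.neg_apply, mul_neg]
    exact neg_mem (hx i).2

variable {p₁ p₂ q}

theorem smul_mem_boundedSeq {a : ℚ} (ha : a ∈ ratLocalization p₂) (ha' : a ∈ ratLocalization q)
    {x : ℕ →₀ ℚ} (hx : x ∈ boundedSeq p₂ q) : a • x ∈ boundedSeq p₂ q := fun i => by
  rw [Finsupp.smul_apply, smul_eq_mul, mul_left_comm]
  exact ⟨mul_mem ha (hx i).1, mul_mem ha' (hx i).2⟩

theorem filter_mem_boundedSeq (P : ℕ → Prop) [DecidablePred P] {x : ℕ →₀ ℚ}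
    (hx : x ∈ boundedSeq p₂ q) : x.filter P ∈ boundedSeq p₂ q := fun i => by
  rw [Finsupp.filter_apply]
  split_ifs
  · exact hx i
  · simp

variable (p₁ p₂ q)

/-- The group generated by `p₁`-divisible elements `eᵢ`, `fᵢ` and `p₂`-divisible elements `d`, `b`,
in which `eᵢ + d + c • b` and `fᵢ + b` are divisible by `q ^ i`; everything is localized at suitable
primes. -/
def twistedGroup (c : ℚ) : AddSubgroup ((ℕ →₀ ℚ) × (ℕ →₀ ℚ) × ℚ × ℚ) where
  carrier := {v | (v.1 ∈ boundedSeq p₂ q ∧ v.2.1 ∈ boundedSeq p₂ q) ∧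
    (v.2.2.1 ∈ ratLocalization p₁ ∧ v.2.2.2 ∈ ratLocalization p₁) ∧
    v.2.2.1 - coordSum v.1 ∈ ratLocalization q ∧
    v.2.2.2 - coordSum v.2.1 - c * coordSum v.1 ∈ ratLocalization q}
  zero_mem' := by simp
  add_mem' {v w} hv hw := by
    refine ⟨⟨add_mem hv.1.1 hw.1.1, add_mem hv.1.2 hw.1.2⟩,
      ⟨add_mem hv.2.1.1 hw.2.1.1, add_mem hv.2.1.2 hw.2.1.2⟩, ?_, ?_⟩
    · convert add_mem hv.2.2.1 hw.2.2.1 using 1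
      simp only [Prod.fst_add, Prod.snd_add, map_add]
      ring
    · convert add_mem hv.2.2.2 hw.2.2.2 using 1
      simp only [Prod.fst_add, Prod.snd_add, map_add]
      ring
  neg_mem' {v} hv := by
    refine ⟨⟨neg_mem hv.1.1, neg_mem hv.1.2⟩, ⟨neg_mem hv.2.1.1, neg_mem hv.2.1.2⟩, ?_, ?_⟩
    · convert neg_mem hv.2.2.1 using 1
      simp only [Prod.fst_neg, Prod.snd_neg, map_neg]
      ring
    · convert neg_mem hv.2.2.2 using 1
      simp only [Prod.fst_neg, Prod.snd_neg, map_neg]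
      ring

/-- The `p₁`-divisible part common to all the groups `twistedGroup p₁ p₂ q c`. -/
def twistedBase : AddSubgroup ((ℕ →₀ ℚ) × (ℕ →₀ ℚ)) where
  carrier := {v | (v.1 ∈ boundedSeq p₂ q ∧ v.2 ∈ boundedSeq p₂ q) ∧
    coordSum v.1 ∈ ratLocalization q ∧ coordSum v.2 ∈ ratLocalization q}
  zero_mem' := by simp
  add_mem' {v w} hv hw := by
    refine ⟨⟨add_mem hv.1.1 hw.1.1, add_mem hv.1.2 hw.1.2⟩, ?_, ?_⟩
    · rw [Prod.fst_add, map_add]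
      exact add_mem hv.2.1 hw.2.1
    · rw [Prod.snd_add, map_add]
      exact add_mem hv.2.2 hw.2.2
  neg_mem' {v} hv := by
    refine ⟨⟨neg_mem hv.1.1, neg_mem hv.1.2⟩, ?_, ?_⟩
    · rw [Prod.fst_neg, map_neg]
      exact neg_mem hv.2.1
    · rw [Prod.snd_neg, map_neg]
      exact neg_mem hv.2.2

variable {p₁ p₂ q}

theorem mem_pOmega_p₁_twistedGroup {c : ℚ} (h12 : p₁ ≠ p₂) (h1q : p₁ ≠ q)
    {v : twistedGroup p₁ p₂ q c} :
    v ∈ pOmega p₁ (twistedGroup p₁ p₂ q c) ↔ v.1.2.2 = 0 := by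
  have hp : (p₁ : ℚ) ≠ 0 := by exact_mod_cast hp₁.out.ne_zero
  constructor
  · intro hv
    have h (n : ℕ) : ∃ w : twistedGroup p₁ p₂ q c, (p₁ : ℚ) ^ n • w.1.2.2 = v.1.2.2 := by
      obtain ⟨w, rfl⟩ := hv n
      refine ⟨w, ?_⟩
      simp [← Nat.cast_smul_eq_nsmul ℚ]
    refine Prod.ext (eq_zero_of_ratLocalization (p := p₁) fun n => ?_)
      (eq_zero_of_ratLocalization (p := p₁) fun n => ?_)
    · obtain ⟨w, hw⟩ := h n
      exact ⟨_, w.2.2.1.1, congrArg Prod.fst hw⟩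
    · obtain ⟨w, hw⟩ := h n
      exact ⟨_, w.2.2.1.2, congrArg Prod.snd hw⟩
  · obtain ⟨⟨x, w, y, z⟩, hv⟩ := v
    rintro h n
    obtain ⟨rfl, rfl⟩ := Prod.mk.inj h
    have ha : ((p₁ : ℚ)⁻¹) ^ n ∈ ratLocalization p₂ :=
      pow_mem (inv_prime_mem_ratLocalization hp₁.out h12) n
    have ha' : ((p₁ : ℚ)⁻¹) ^ n ∈ ratLocalization q :=
      pow_mem (inv_prime_mem_ratLocalization hp₁.out h1q) n
    refine ⟨⟨(((p₁ : ℚ)⁻¹) ^ n • x, ((p₁ : ℚ)⁻¹) ^ n • w, 0, 0),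
      ⟨smul_mem_boundedSeq ha ha' hv.1.1, smul_mem_boundedSeq ha ha' hv.1.2⟩,
      ⟨zero_mem _, zero_mem _⟩, ?_, ?_⟩, Subtype.ext ?_⟩
    · convert mul_mem ha' hv.2.2.1 using 1
      simp only [coordSum_smul]
      ring
    · convert mul_mem ha' hv.2.2.2 using 1
      simp only [coordSum_smul]
      ring
    · simp [← Nat.cast_smul_eq_nsmul ℚ, smul_smul, hp]

theorem mem_pOmega_p₂_twistedGroup {c : ℚ} {v : twistedGroup p₁ p₂ q c}
    (hv : v ∈ pOmega p₂ (twistedGroup p₁ p₂ q c)) : v.1.1 = 0 ∧ v.1.2.1 = 0 := by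
  constructor <;> ext i <;> refine eq_zero_of_ratLocalization (p := p₂) fun n => ?_
  · obtain ⟨w, rfl⟩ := hv n
    exact ⟨w.1.1 i, (w.2.1.1 i).1, by simp⟩
  · obtain ⟨w, rfl⟩ := hv n
    exact ⟨w.1.2.1 i, (w.2.1.2 i).1, by simp⟩

/-- The inclusion of the base. -/
noncomputable def twistedIncl {c : ℚ} (hc : c ∈ ratLocalization q) :
    ULift.{u} (twistedBase p₂ q) →+ ULift.{u} (twistedGroup p₁ p₂ q c) where
  toFun v := ⟨⟨(v.down.1.1, v.down.1.2, 0, 0), v.down.2.1, ⟨zero_mem _, zero_mem _⟩,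
    sub_mem (zero_mem _) v.down.2.2.1,
    sub_mem (sub_mem (zero_mem _) v.down.2.2.2) (mul_mem hc v.down.2.2.1)⟩⟩
  map_zero' := rfl
  map_add' v w := ULift.ext _ _ (Subtype.ext (by simp))

theorem twistedIncl_injective {c : ℚ} (hc : c ∈ ratLocalization q) :
    Function.Injective (twistedIncl.{u} (p₁ := p₁) (p₂ := p₂) hc) := fun v w h => by
  have h' : (v.down.1.1, v.down.1.2, (0 : ℚ), (0 : ℚ)) = (w.down.1.1, w.down.1.2, 0, 0) :=
    congrArg (fun y => y.down.1) h
  simp only [Prod.mk.injEq, and_true] at h'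
  exact ULift.ext _ _ (Subtype.ext (Prod.ext h'.1 h'.2))

theorem twistedIncl_range {c : ℚ} (h12 : p₁ ≠ p₂) (h1q : p₁ ≠ q) (hc : c ∈ ratLocalization q) :
    (twistedIncl.{u} (p₁ := p₁) (p₂ := p₂) hc).range = pOmega p₁ _ := by
  ext v
  rw [pOmega_ulift, mem_pOmega_p₁_twistedGroup h12 h1q]
  constructor
  · rintro ⟨w, rfl⟩
    rfl
  · obtain ⟨⟨⟨x, w, y, z⟩, hv⟩⟩ := v
    intro h
    obtain ⟨rfl, rfl⟩ := Prod.mk.inj h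
    have h1 : coordSum x ∈ ratLocalization q := by simpa using hv.2.2.1
    refine ⟨⟨⟨(x, w), hv.1, h1, ?_⟩⟩, rfl⟩
    simpa using neg_mem (add_mem hv.2.2.2 (mul_mem hc h1))

theorem K1_twistedIncl_isEmb {c : ℚ} (h12 : p₁ ≠ p₂) (h1q : p₁ ≠ q) (hc : c ∈ ratLocalization q) :
    (K1.{u} p₁ p₂).IsEmb (twistedIncl.{u} (p₁ := p₁) (p₂ := p₂) hc) := by
  rw [K1_isEmb_iff hp₁.out hp₂.out, twistedIncl_range h12 h1q hc]
  exact ⟨twistedIncl_injective hc, K1Mem_of_countable, isDivClosed_pOmega hp₁.out, le_rfl,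
    Or.inl le_rfl⟩

/-- The triple `(b, M, N)` for the group with twist `c`. -/
noncomputable def twistedTriple {c : ℚ} (hc : c ∈ ratLocalization q) :
    (K1.{u} p₁ p₂).Triple (ULift.{u} (twistedBase p₂ q)) where
  N := ULift.{u} (twistedGroup p₁ p₂ q c)
  mem := K1Mem_of_countable
  incl := ⟨twistedIncl hc, twistedIncl_injective hc⟩
  b := ⟨⟨(0, 0, 0, 1), by
    refine ⟨⟨zero_mem _, zero_mem _⟩, ⟨zero_mem _, one_mem _⟩, ?_, ?_⟩ <;> simp⟩⟩

theorem twistedTriple_isStrong {c : ℚ} (h12 : p₁ ≠ p₂) (h1q : p₁ ≠ q) (hc : c ∈ ratLocalization q) :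
    (twistedTriple.{u} (p₁ := p₁) (p₂ := p₂) hc).IsStrong :=
  ⟨twistedIncl hc, fun _ => rfl, K1_twistedIncl_isEmb h12 h1q hc⟩

/-- The basis elements `eᵢ`. -/
noncomputable def twistedBasis (i : ℕ) : ULift.{u} (twistedBase p₂ q) :=
  ⟨⟨(Finsupp.single i 1, 0), by
    refine ⟨⟨fun j => ?_, zero_mem _⟩, ?_, ?_⟩
    · rw [Finsupp.single_apply]
      split_ifs
      · exact ⟨one_mem _, mul_mem (pow_mem (natCast_mem _ _) _) (one_mem _)⟩
      · simp
    · rw [coordSum_single]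
      exact one_mem _
    · simp⟩⟩

theorem twistedBasis_injective : Function.Injective (twistedBasis.{u} (p₂ := p₂) (q := q)) := by
  intro i j h
  have h' : Finsupp.single i (1 : ℚ) = Finsupp.single j 1 := congrArg (fun y => y.down.1.1) h
  exact (Finsupp.single_left_inj one_ne_zero).mp h'

/-- `b` is not `p₁`-divisible, and some `p₂`-divisible `d` is congruent to `-eᵢ` modulo `l ^ i` for
all `i`. -/
def HasDivisibleLimit (l : ℕ) {A : Type u} (e : ℕ → A) (s : (K1.{u} p₁ p₂).Triple A) : Prop :=
  s.b ∉ pOmega p₁ s.N ∧ ∃ d ∈ pOmega p₂ s.N, ∀ i, ∃ y, ((l ^ i : ℕ) : ℤ) • y = s.incl (e i) + d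

/-- Since `b` is not `p₁`-divisible, embeddings add no `p₂`-divisible elements, so the image of the
witness `d` in a common extension already comes from the other model. -/
theorem HasDivisibleLimit.of_gtp_eq {l : ℕ} {A : Type u} {e : ℕ → A} {s t : (K1.{u} p₁ p₂).Triple A}
    (hs : HasDivisibleLimit l e s) (h : gtp s = gtp t) : HasDivisibleLimit l e t := by
  refine K1_gtp_eq_imp hp₁.out hp₂.out _ ?_ h hs
  rintro s t ⟨N, _, f, g, hN, hf, hg, hA, hb⟩ ⟨hbs, d, hd, hy⟩
  have hbt : t.b ∉ pOmega p₁ t.N := by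
    rwa [← K1_isEmb_mem_pOmega_iff hp₁.out hp₂.out hg, ← hb,
      K1_isEmb_mem_pOmega_iff hp₁.out hp₂.out hf]
  have hfd := (K1_isEmb_mem_pOmega_iff hp₁.out hp₂.out hf).mpr hd
  obtain ⟨d', hd'⟩ := K1_isEmb_pOmega_le hp₁.out hp₂.out hg hbt hfd
  refine ⟨hbt, d', (K1_isEmb_mem_pOmega_iff hp₁.out hp₂.out hg).mp (hd' ▸ hfd), fun i => ?_⟩
  obtain ⟨y, hy⟩ := hy i
  refine (K1_isEmb_zsmul_iff hp₁.out hp₂.out hg).mp ⟨f y, ?_⟩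
  rw [← map_zsmul, hy, map_add, map_add, hA, hd']

theorem twistedTriple_b_notMem {c : ℚ} (h12 : p₁ ≠ p₂) (h1q : p₁ ≠ q) (hc : c ∈ ratLocalization q) :
    (twistedTriple.{u} (p₁ := p₁) (p₂ := p₂) hc).b ∉ pOmega p₁ _ := by
  intro h
  have h' := (mem_pOmega_p₁_twistedGroup h12 h1q).mp (pOmega_ulift.mp h)
  exact one_ne_zero (congrArg Prod.snd h')

theorem hasDivisibleLimit_twistedTriple_zero (h12 : p₁ ≠ p₂) (h1q : p₁ ≠ q) (h2q : p₂ ≠ q) :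
    HasDivisibleLimit q twistedBasis
      (twistedTriple.{u} (p₁ := p₁) (p₂ := p₂) (zero_mem (ratLocalization q))) := by
  have hq0 : (q : ℚ) ≠ 0 := by exact_mod_cast hq.out.ne_zero
  have hp0 : (p₂ : ℚ) ≠ 0 := by exact_mod_cast hp₂.out.ne_zero
  have hmem {a : ℚ} (ha : a ∈ ratLocalization p₁) (ha' : a ∈ ratLocalization q) :
      ((0, 0, a, 0) : (ℕ →₀ ℚ) × (ℕ →₀ ℚ) × ℚ × ℚ) ∈ twistedGroup p₁ p₂ q 0 := by
    refine ⟨⟨zero_mem _, zero_mem _⟩, ⟨ha, zero_mem _⟩, ?_, ?_⟩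
    · simpa using ha'
    · simp
  refine ⟨twistedTriple_b_notMem h12 h1q _, ⟨⟨_, hmem (one_mem _) (one_mem _)⟩⟩,
    pOmega_ulift.mpr fun n => ?_, fun i => ?_⟩
  · refine ⟨⟨_, hmem (pow_mem (inv_prime_mem_ratLocalization hp₂.out h12.symm) n)
      (pow_mem (inv_prime_mem_ratLocalization hp₂.out h2q) n)⟩, Subtype.ext ?_⟩
    simp [← Nat.cast_smul_eq_nsmul ℚ, hp0]
  · have hp (r : ℕ) [Fact r.Prime] (hr : r ≠ q) : ((q : ℚ) ^ i)⁻¹ ∈ ratLocalization r := by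
      rw [← inv_pow]
      exact pow_mem (inv_prime_mem_ratLocalization hq.out hr.symm) i
    refine ⟨⟨⟨(Finsupp.single i ((q : ℚ) ^ i)⁻¹, 0, ((q : ℚ) ^ i)⁻¹, 0), ⟨fun j => ?_, zero_mem _⟩,
      ⟨hp p₁ h1q, zero_mem _⟩, ?_, ?_⟩⟩, ULift.ext _ _ (Subtype.ext ?_)⟩
    · rw [Finsupp.single_apply]
      split_ifs with h
      · subst h
        refine ⟨hp p₂ h2q, ?_⟩
        rw [mul_inv_cancel₀ (pow_ne_zero _ hq0)]
        exact one_mem _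
      · simp
    · simp [coordSum_single]
    · simp
    · show ((q ^ i : ℕ) : ℤ) • (Finsupp.single i ((q : ℚ) ^ i)⁻¹, 0, ((q : ℚ) ^ i)⁻¹, 0) =
        ((Finsupp.single i 1, 0, 0, 0) + (0, 0, 1, 0) : (ℕ →₀ ℚ) × (ℕ →₀ ℚ) × ℚ × ℚ)
      simp [hq0, -natCast_zsmul, -Nat.cast_pow, ← Int.cast_smul_eq_zsmul ℚ]

theorem not_hasDivisibleLimit_twistedTriple {c : ℚ} (hc : c ∈ ratLocalization q)
    (hc' : c ∉ ratLocalization p₁) : ¬ HasDivisibleLimit q twistedBasis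
      (twistedTriple.{u} (p₁ := p₁) (p₂ := p₂) hc) := by
  rintro ⟨-, ⟨⟨⟨x, w, y, z⟩, hd⟩⟩, hdiv, h⟩
  obtain ⟨rfl, rfl⟩ : x = 0 ∧ w = 0 := mem_pOmega_p₂_twistedGroup (pOmega_ulift.mp hdiv)
  apply hc'
  -- Dividing `eᵢ + d` by `q ^ i` makes `z - c` a `q ^ i`-multiple in `ℤ_(q)` for every `i`. Hence
  -- `z = c`, although `z` must lie in `ℤ_(p₁)`.
  suffices z - c * 1 = 0 by
    rw [show c = z by linear_combination -this]
    exact hd.2.1.2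
  refine eq_zero_of_ratLocalization (p := q) fun i => ?_
  obtain ⟨⟨v⟩, hv⟩ := h i
  have hv : ((q ^ i : ℕ) : ℤ) • v.1 = (Finsupp.single i 1, 0, 0, 0) + (0, 0, y, z) :=
    congrArg (fun y => y.down.1) hv
  refine ⟨_, v.2.2.2.2, ?_⟩
  have e₁ : coordSum (((q ^ i : ℕ) : ℤ) • v.1).1 = 1 := by
    rw [hv]
    simp [coordSum_single]
  have e₂ : coordSum (((q ^ i : ℕ) : ℤ) • v.1).2.1 = 0 := by
    rw [hv]
    simp
  have e₃ : ((q ^ i : ℕ) : ℤ) • v.1.2.2.2 = z :=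
    (congrArg (fun y => y.2.2.2) hv).trans (zero_add z)
  simp only [Prod.smul_fst, Prod.smul_snd, map_zsmul, zsmul_eq_mul] at e₁ e₂ e₃
  push_cast at e₁ e₂ e₃
  linear_combination e₃ - e₂ - c * e₁

/-- The shear `(x, w, y, z) ↦ (x, w + a • x|_{≥ r}, y, z + t * y)`. -/
noncomputable def shear (r : ℕ) (a t : ℚ) :
    (ℕ →₀ ℚ) × (ℕ →₀ ℚ) × ℚ × ℚ →+ (ℕ →₀ ℚ) × (ℕ →₀ ℚ) × ℚ × ℚ where
  toFun v := (v.1, v.2.1 + a • v.1.filter (r ≤ ·), v.2.2.1, v.2.2.2 + t * v.2.2.1)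
  map_zero' := by simp [Finsupp.filter_zero]
  map_add' v w := by
    refine Prod.ext rfl (Prod.ext ?_ (Prod.ext rfl ?_))
    · simp only [Prod.fst_add, Prod.snd_add, Finsupp.filter_add, smul_add]
      exact add_add_add_comm _ _ _ _
    · simp only [Prod.fst_add, Prod.snd_add, mul_add]
      exact add_add_add_comm _ _ _ _

/-- The last defining condition changes by `t` times the third one plus `a` times the sum of the
`xᵢ` with `i < r`. That sum has denominators of `q`-power below `q ^ r`, which `a` absorbs; the
terms with `i ≥ r` are compensated in the second sequence. -/
theorem shear_mem {c c' a t : ℚ} {r : ℕ} (hat : a = t - (c' - c)) (ht : t ∈ ratLocalization p₁)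
    (ht' : t ∈ ratLocalization q) (ha : a ∈ ratLocalization p₂)
    (ha' : ∃ u ∈ ratLocalization q, (q : ℚ) ^ r * u = a)
    {v : (ℕ →₀ ℚ) × (ℕ →₀ ℚ) × ℚ × ℚ} (hv : v ∈ twistedGroup p₁ p₂ q c) :
    shear r a t v ∈ twistedGroup p₁ p₂ q c' := by
  obtain ⟨u, hu, hur⟩ := ha'
  have haq : a ∈ ratLocalization q := hur ▸ mul_mem (pow_mem (natCast_mem _ _) _) hu
  refine ⟨⟨hv.1.1, add_mem hv.1.2 (smul_mem_boundedSeq ha haq (filter_mem_boundedSeq _ hv.1.1))⟩,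
    ⟨hv.2.1.1, add_mem hv.2.1.2 (mul_mem ht hv.2.1.1)⟩, hv.2.2.1, ?_⟩
  have hlow : a * coordSum (v.1.filter fun i => ¬ r ≤ i) ∈ ratLocalization q := by
    rw [← coordSum_smul]
    refine coordSum_mem (ratLocalization q).toAddSubgroup fun i => ?_
    rw [Finsupp.smul_apply, Finsupp.filter_apply]
    split_ifs with hi
    · simp
    · have e : a • v.1 i = u * (q : ℚ) ^ (r - i) * ((q : ℚ) ^ i * v.1 i) := by
        rw [← hur, smul_eq_mul, show (q : ℚ) ^ r = q ^ (r - i) * q ^ i by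
          rw [← pow_add]
          congr 1
          omega]
        ring
      rw [e]
      show _ ∈ ratLocalization q
      exact mul_mem (mul_mem hu (pow_mem (natCast_mem _ _) _)) (hv.1.1 i).2
  have hsum : coordSum (v.1.filter (r ≤ ·)) + coordSum (v.1.filter fun i => ¬ r ≤ i)
      = coordSum v.1 := by
    rw [← map_add, Finsupp.filter_add_filter_not]
  convert add_mem (add_mem hv.2.2.2 (mul_mem ht' hv.2.2.1)) hlow using 1
  simp only [shear, AddMonoidHom.coe_mk, ZeroHom.coe_mk, map_add, coordSum_smul]
  linear_combination -a * hsum - coordSum v.1 * hat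

theorem shear_neg_shear (r : ℕ) (a t : ℚ) (v : (ℕ →₀ ℚ) × (ℕ →₀ ℚ) × ℚ × ℚ) :
    shear r (-a) (-t) (shear r a t v) = v := by
  refine Prod.ext rfl (Prod.ext ?_ (Prod.ext rfl ?_)) <;> simp [shear]

/-- The shear as an isomorphism of groups with different twists. -/
noncomputable def shearEquiv {c c' a t : ℚ} {r : ℕ} (hat : a = t - (c' - c))
    (ht : t ∈ ratLocalization p₁) (ht' : t ∈ ratLocalization q) (ha : a ∈ ratLocalization p₂)
    (ha' : ∃ u ∈ ratLocalization q, (q : ℚ) ^ r * u = a) :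
    twistedGroup p₁ p₂ q c ≃+ twistedGroup p₁ p₂ q c' where
  toFun v := ⟨_, shear_mem hat ht ht' ha ha' v.2⟩
  invFun v := ⟨shear r (-a) (-t) v, shear_mem (by rw [hat]; ring) (neg_mem ht) (neg_mem ht')
    (neg_mem ha) (ha'.imp' (- ·) fun u h => ⟨neg_mem h.1, by rw [← h.2]; ring⟩) v.2⟩
  left_inv v := Subtype.ext (shear_neg_shear r a t v)
  right_inv v := Subtype.ext (by simpa using shear_neg_shear r (-a) (-t) v.1)
  map_add' v w := Subtype.ext (map_add (shear r a t) v.1 w.1)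

/-- Although `1/p₁` is not in `ℤ_(p₁)`, Bézout gives an integer congruent to it modulo `q ^ r`, and
integers are legitimate shear coefficients. -/
theorem exists_int_approx (h1q : p₁ ≠ q) (r : ℕ) :
    ∃ t : ℤ, ∃ u ∈ ratLocalization q, (q : ℚ) ^ r * u = t - (p₁ : ℚ)⁻¹ := by
  have hp : (p₁ : ℚ) ≠ 0 := by exact_mod_cast hp₁.out.ne_zero
  obtain ⟨t, m, h⟩ : IsCoprime (p₁ : ℤ) ((q ^ r : ℕ) : ℤ) :=
    Nat.isCoprime_iff_coprime.mpr (((Nat.coprime_primes hp₁.out hq.out).mpr h1q).pow_right r)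
  refine ⟨t, -m * (p₁ : ℚ)⁻¹, mul_mem (neg_mem (intCast_mem _ m))
    (inv_prime_mem_ratLocalization hp₁.out h1q), ?_⟩
  have h' : (t : ℚ) * p₁ + m * q ^ r = 1 := by exact_mod_cast h
  field_simp
  linear_combination -h'

theorem gtp_restrict_twistedTriple (h12 : p₁ ≠ p₂) (h1q : p₁ ≠ q)
    (hc : (p₁ : ℚ)⁻¹ ∈ ratLocalization q) {A : Set (ULift.{u} (twistedBase p₂ q))} (hA : A.Finite) :
    gtp ((twistedTriple.{u} (p₁ := p₁) (p₂ := p₂) (zero_mem (ratLocalization q))).restrict A) =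
      gtp ((twistedTriple.{u} (p₁ := p₁) (p₂ := p₂) hc).restrict A) := by
  -- Beyond the first-sequence supports of the finitely many parameters, the shear may act freely;
  -- it also fixes `b`, whose third coordinate is `0`.
  obtain ⟨r, hr⟩ : ∃ r, ∀ a ∈ A, ∀ i, r ≤ i → a.down.1.1 i = 0 := by
    obtain ⟨r, hr⟩ := (hA.biUnion fun a _ => (a.down.1.1.support.finite_toSet)).bddAbove
    refine ⟨r + 1, fun a ha i hi => ?_⟩
    by_contra h
    have := hr (Set.mem_biUnion ha (Finsupp.mem_support_iff.mpr h))
    omega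
  obtain ⟨t, ht⟩ := exists_int_approx (p₁ := p₁) h1q r
  let e := shearEquiv (p₁ := p₁) (p₂ := p₂) (q := q) (c := 0) (c' := (p₁ : ℚ)⁻¹)
    (a := t - (p₁ : ℚ)⁻¹) (t := t) (r := r) (by ring) (intCast_mem _ t) (intCast_mem _ t)
    (sub_mem (intCast_mem _ t) (inv_prime_mem_ratLocalization hp₁.out h12)) ht
  let e' : ULift.{u} (twistedGroup p₁ p₂ q 0) ≃+ ULift.{u} (twistedGroup p₁ p₂ q (p₁ : ℚ)⁻¹) :=
    AddEquiv.ulift.trans (e.trans AddEquiv.ulift.symm)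
  refine K1_gtp_eq_of_Eat hp₁.out hp₂.out ⟨ULift.{u} (twistedGroup p₁ p₂ q (p₁ : ℚ)⁻¹), inferInstance,
    e'.toAddMonoidHom, .id _, K1Mem_of_countable,
    K1_isEmb_addEquiv hp₁.out hp₂.out K1Mem_of_countable e',
    K1_isEmb_id hp₁.out hp₂.out (twistedTriple hc).mem, ?_, ?_⟩
  · rintro ⟨a, haA⟩
    refine ULift.ext _ _ (Subtype.ext ?_)
    show (a.down.1.1, a.down.1.2 + _ • a.down.1.1.filter (r ≤ ·), (0 : ℚ), (0 : ℚ) + t * 0) =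
      (a.down.1.1, a.down.1.2, 0, 0)
    rw [show a.down.1.1.filter (r ≤ ·) = 0 from
      (Finsupp.filter_eq_zero_iff _ _).2 fun i hi => hr a haA i hi]
    simp
  · refine ULift.ext _ _ (Subtype.ext ?_)
    show ((0 : ℕ →₀ ℚ), (0 : ℕ →₀ ℚ) + _ • (0 : ℕ →₀ ℚ).filter (r ≤ ·), (0 : ℚ), (1 : ℚ) + t * 0) =
      (0, 0, 0, 1)
    simp [Finsupp.filter_zero]

end NonTameness

theorem K1_not_ltTame_aleph0 {p₁ p₂ : ℕ} (hp₁ : p₁.Prime) (hp₂ : p₂.Prime) (hne : p₁ ≠ p₂) :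
    ¬ (K1.{u} p₁ p₂).LtTame ℵ₀ := by
  -- The bound only makes `q` a third prime.
  obtain ⟨q, hq, hqp⟩ := Nat.exists_infinite_primes (p₁ + p₂ + 1)
  have := Fact.mk hp₁
  have := Fact.mk hp₂
  have := Fact.mk hqp
  have h1q : p₁ ≠ q := by omega
  have h2q : p₂ ≠ q := by omega
  have hc : (p₁ : ℚ)⁻¹ ∈ ratLocalization q := inv_prime_mem_ratLocalization hp₁ h1q
  intro h
  have : Infinite (ULift.{u} (twistedBase p₂ q)) := .of_injective _ twistedBasis_injective
  obtain ⟨A, hA, hA'⟩ := h _ (Cardinal.aleph0_le_mk _) (ULift.{u} (twistedBase p₂ q))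
    K1Mem_of_countable rfl _ _ (twistedTriple_isStrong hne h1q (zero_mem (ratLocalization q)))
    (twistedTriple_isStrong hne h1q hc) fun h =>
      not_hasDivisibleLimit_twistedTriple hc inv_self_notMem_ratLocalization
        ((hasDivisibleLimit_twistedTriple_zero hne h1q h2q).of_gtp_eq h)
  exact hA' (gtp_restrict_twistedTriple hne h1q hc (Cardinal.lt_aleph0_iff_set_finite.mp hA))

theorem theorem3p2 (p₁ p₂ : ℕ) (hp₁ : p₁.Prime) (hp₂ : p₂.Prime) (hne : p₁ ≠ p₂) :
    (K1.{u} p₁ p₂).IsAEC ∧ (K1.{u} p₁ p₂).LS = ℵ₀ ∧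
    ¬ (K1.{u} p₁ p₂).LtTame ℵ₀ ∧
    (K1.{u} p₁ p₂).Tame ℵ₀ ∧
    (∀ μ : Cardinal.{u}, ℵ₀ ≤ μ → ((K1.{u} p₁ p₂).StableIn μ ↔ μ ^ (ℵ₀ : Cardinal.{u}) = μ)) ∧
    ((K1.{u} p₁ p₂).NoMaximalModels ∧ ¬ (K1.{u} p₁ p₂).JointEmbedding ∧
      ¬ (K1.{u} p₁ p₂).Amalgamation) ∧
    (K1.{u} p₁ p₂).AdmitsIntersections :=
  ⟨K1_isAEC hp₁ hp₂, K1_LS hp₁ hp₂, K1_not_ltTame_aleph0 hp₁ hp₂ hne, K1_tame_aleph0 hp₁ hp₂,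
    fun _ hμ => ⟨power_eq_of_K1_stableIn hp₁ hp₂ hμ, K1_stableIn_of_power_eq hp₁ hp₂ hμ⟩,
    ⟨K1_noMaximalModels hp₁ hp₂, K1_not_jointEmbedding hp₁ hp₂, K1_not_amalgamation hp₁ hp₂ hne⟩,
    K1_admitsIntersections hp₁ hp₂⟩
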